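/- \textbf{Lemma (Overlap for a critical GTS pair).} \emph{Graphs and rules.} Fix a finite directed multigraph $TG$ (the type graph). Typed graphs are finite graphs $G$ with a graph morphism $\mathrm{type}_G$ to $TG$; morphisms of typed graphs preserve types. A rule $p=(L\xleftarrow{l}K\xrightarrow{r}R)$ consists of typed graphs with inclusions (injective morphisms) $l,r$; we regard $K$ as a subgraph of $L$ and of $R$. $G\stackrel{p,m}{\Longrightarrow}H$ means that the match $m:L\to G$ is injective and there are a typed graph $D$ and morphisms such that $L\leftarrow K\to D$ has pushout $G$ (with $m$ as the map from $L$) and $R\leftarrow K\to D$ has pushout $H$. A pair $P_1\stackrel{r_1,m_1}{\Longleftarrow}G\stackrel{r_2,m_2}{\Longrightarrow}P_2$ is a \emph{critical GTS pair} if $m_1(L_1)\cap m_2(L_2)\not\subseteq m_1(K_1)\cap m_2(K_2)$ (for nodes and edges together) and every node and edge of $G$ lies in $m_1(L_1)\cup m_2(L_2)$. Let $\deg_G(v)$ be the number of edges with source $v$ plus the number of edges with target $v$. \emph{CHR.} Let $CT$ be a first-order theory of built-in constraints that contains Clark's equality theory for its free function symbols, among them the integer constants, and that evaluates $+$ and $-$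 correctly on integers. A \emph{state} $\langle\mathbb G;\mathbb B;\mathbb V\rangle$ consists of a multiset $\mathbb G$ of user-defined constraints, a conjunction $\mathbb B$ of built-in constraints, and a set $\mathbb V$ of global variables from an infinite set of variables. State equivalence $\equiv$ is the smallest equivalence relation such that (1) $\langle\mathbb G;x{=}t\wedge\mathbb B;\mathbb V\rangle\equiv\langle\mathbb G[x/t];x{=}t\wedge\mathbb B;\mathbb V\rangle$; (2) $\langle\mathbb G;\mathbb B;\mathbb V\rangle\equiv\langle\mathbb G;\mathbb B';\mathbb V\rangle$ if $CT\models\exists\bar s.\mathbb B\leftrightarrow\exists\bar s'.\mathbb B'$, where $\bar s,\bar s'$ are the variables of $\mathbb B,\mathbb B'$ outside $\mathbb V\cup\mathrm{vars}(\mathbb G)$; (3) $\langle\mathbb G;\mathbb B;\{X\}\cup\mathbb V\rangle\equiv\langle\mathbb G;\mathbb B;\mathbb V\rangle$ if $X$ does not occur in $\mathbb G,\mathbb B$; (4) $\langle\mathbb G;\bot;\mathbb V\rangle\equiv\langle\mathbb G';\bot;\mathbb V\rangle$. Let $C_i\Leftrightarrow B_i^u,B_i^b$ ($i=1,2$) be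 two simplification rules, renamed apart. If the heads are split as $C_i=H_i\uplus A_i$ with $A_1,A_2$ non-empty, and $A_1=A_2$ denotes the conjunction of the equations obtained by equating the constraints of $A_1$ with those of $A_2$ one by one (along some bijection), and $CT\models\exists(A_1=A_2)$, then, with $\mathbb V=\mathrm{vars}(H_1\uplus A_1\uplus H_2\uplus A_2)$, the state $\sigma_{CP}=\langle H_1\uplus A_1\uplus H_2;A_1=A_2;\mathbb V\rangle$ is an \emph{overlap} of the two rules, and its \emph{critical CHR pair} is $(\sigma_1,\sigma_2)$ with $\sigma_1=\langle B_1^u\uplus H_2;B_1^b\wedge(A_1=A_2);\mathbb V\rangle$ and $\sigma_2=\langle B_2^u\uplus H_1;B_2^b\wedge(A_1=A_2);\mathbb V\rangle$. \emph{Encoding.} Each node of $TG$ is a binary, each edge of $TG$ a ternary user-defined constraint symbol. Let $\mathrm{var}$ and $\mathrm{dvar}$ assign pairwise different variables to nodes and edges. For a node $v$ of $G$ let $\mathrm{chr}_G(\mathsf{gnd},v)=\mathrm{type}_G(v)(\mathrm{var}(v),\deg_G(v))$ and $\mathrm{chr}_G(\mathsf{keep},v)=\mathrm{type}_G(v)(\mathrm{var}(v),\mathrm{dvar}(v))$;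 for an edge $e$ let $\mathrm{chr}_G(\mathsf{gnd},e)=\mathrm{chr}_G(\mathsf{keep},e)=\mathrm{type}_G(e)(\mathrm{var}(e),\mathrm{var}(\mathrm{src}\,e),\mathrm{var}(\mathrm{tgt}\,e))$; and let $\mathrm{chr}(\mathsf{gnd},G)$ be the multiset of all $\mathrm{chr}_G(\mathsf{gnd},x)$, $x$ a node or edge of $G$. The encoding $\varrho(p)$ of a rule $p$ is the simplification rule $C_L\Leftrightarrow C_R^u,C_R^b$, where, with a fresh copy $v'$ for each node $v$ of $K$, $C_L=\{\mathrm{chr}_L(\mathsf{keep},x)\mid x\in K\}\uplus\{\mathrm{chr}_L(\mathsf{gnd},x)\mid x\in L\setminus K\}$, $C_R^u=\{\mathrm{chr}_R(\mathsf{gnd},x)\mid x\in R\setminus K\}\uplus\{\mathrm{chr}_R(\mathsf{keep},e)\mid e\in E_K\}\uplus\{\mathrm{type}_K(v)(\mathrm{var}(v'),\mathrm{dvar}(v'))\mid v\in V_K\}$, and $C_R^b=\bigwedge_{v\in V_K}\big(\mathrm{var}(v)=\mathrm{var}(v')\wedge\mathrm{dvar}(v')=\mathrm{dvar}(v)-\deg_L(v)+\deg_R(v)\big)$.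 A state $\sigma$ is a \emph{$\mathcal G$-state based on} a typed graph $G$ if, up to state equivalence, $\sigma=\langle\mathbb G;\mathbb B;\mathbb V\rangle$, where $\mathbb B$ is a conjunction of constraints $X=c$ and $X=Y+c_1-c_2$ (also written $X=Y-c_2+c_1$, and $X=Y$ if $c_1=c_2=0$), $X,Y$ being variables and $c,c_1,c_2$ integer constants, and if there is a conjunction $B$ of constraints of the form $X=c$ with $\langle\mathbb G;\mathbb B\wedge B;\emptyset\rangle\equiv\langle\mathrm{chr}(\mathsf{gnd},G);\top;\emptyset\rangle$ for some choice of the identifier variables of $G$. \emph{Claim.} If $P_1\stackrel{r_1,m_1}{\Longleftarrow}G\stackrel{r_2,m_2}{\Longrightarrow}P_2$ is a critical GTS pair, then there exists an overlap $\sigma_{CP}$ of $\varrho(r_1)$ and $\varrho(r_2)$, with critical CHR pair $(\sigma_1,\sigma_2)$, such that $\sigma_{CP}$ is a $\mathcal G$-state based on $G$, $\sigma_1$ is a $\mathcal G$-state based on $P_1$, and $\sigma_2$ is a $\mathcal G$-state based on $P_2$. -/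

import Mathlib

open CategoryTheory

universe a b u v w

/-! ## Typed graphs and graph transformation (double-pushout approach) -/

namespace GTS

/-- A (finite, directed, multi-)graph. Type graphs are graphs, too. -/
structure Graph : Type (b + 1) where
  V : Type b
  E : Type b
  [finV : Fintype V]
  [finE : Fintype E]
  src : E → V
  tgt : E → V

attribute [instance] Graph.finV Graph.finE

/-- Graph morphisms. -/
@[ext] structure Graph.Hom (G : Graph.{a}) (H : Graph.{b}) where
  onV : G.V → H.V
  onE : G.E → H.E
  src_comm : ∀ e, onV (G.src e) = H.src (onE e)
  tgt_comm : ∀ e, onV (G.tgt e) = H.tgt (onE e)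

/-- The items (nodes and edges) of a graph. -/
abbrev Graph.Item (G : Graph.{b}) : Type b := G.V ⊕ G.E

open Classical in
/-- The degree of a node: edges leaving it plus edges entering it (a loop counts twice). -/
noncomputable def Graph.deg (G : Graph.{b}) (x : G.V) : ℕ :=
  (Finset.univ.filter (fun e => G.src e = x)).card +
    (Finset.univ.filter (fun e => G.tgt e = x)).card

/-- A graph typed over the type graph `TG`. -/
structure TypedGraph (TG : Graph.{a}) extends Graph.{b} where
  typ : Graph.Hom toGraph TG

/-- Morphisms of typed graphs: graph morphisms that preserve types. -/
@[ext] structure TypedGraph.Hom {TG : Graph.{a}} (G H : TypedGraph.{a, b} TG)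
    extends Graph.Hom G.toGraph H.toGraph where
  typV : ∀ x, H.typ.onV (onV x) = G.typ.onV x
  typE : ∀ e, H.typ.onE (onE e) = G.typ.onE e

instance (TG : Graph.{a}) : Category (TypedGraph.{a, b} TG) where
  Hom G H := TypedGraph.Hom G H
  id G :=
    { onV := id, onE := id, src_comm := fun _ => rfl, tgt_comm := fun _ => rfl
      typV := fun _ => rfl, typE := fun _ => rfl }
  comp f g :=
    { onV := g.onV ∘ f.onV
      onE := g.onE ∘ f.onE
      src_comm := fun e => by simp [f.src_comm, g.src_comm]
      tgt_comm := fun e => by simp [f.tgt_comm, g.tgt_comm]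
      typV := fun x => by simp [f.typV, g.typV]
      typE := fun e => by simp [f.typE, g.typE] }

section

variable {TG : Graph.{a}}

/-- The node component of a morphism. -/
def nodeMap {G H : TypedGraph.{a, b} TG} (f : G ⟶ H) : G.V → H.V :=
  (show TypedGraph.Hom G H from f).onV

/-- The edge component of a morphism. -/
def edgeMap {G H : TypedGraph.{a, b} TG} (f : G ⟶ H) : G.E → H.E :=
  (show TypedGraph.Hom G H from f).onE

/-- The action of a morphism on items. -/
def itemMap {G H : TypedGraph.{a, b} TG} (f : G ⟶ H) : G.Item → H.Item :=
  Sum.map (nodeMap f) (edgeMap f)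

/-- A morphism is injective if both of its components are. -/
def Inj {G H : TypedGraph.{a, b} TG} (f : G ⟶ H) : Prop :=
  Function.Injective (nodeMap f) ∧ Function.Injective (edgeMap f)

/-- A graph production rule `L ← K → R`. The inclusions of the context graph `K` are
represented by injective morphisms. -/
structure Rule (TG : Graph.{a}) where
  L : TypedGraph.{a, b} TG
  K : TypedGraph.{a, b} TG
  R : TypedGraph.{a, b} TG
  l : K ⟶ L
  r : K ⟶ R
  inj_l : Inj l
  inj_r : Inj r

/-- `G ⟹ H` by the rule `p` and the injective match `m`: a double pushout in the category of
typed graphs. -/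
def DirectTransformation (p : Rule.{a, b} TG) (G H : TypedGraph.{a, b} TG) (m : p.L ⟶ G) :
    Prop :=
  Inj m ∧ ∃ (D : TypedGraph.{a, b} TG) (k : p.K ⟶ D) (f : D ⟶ G) (n : p.R ⟶ H) (g : D ⟶ H),
    IsPushout p.l k m f ∧ IsPushout p.r k n g

/-- Parallel independence: `m₁(L₁) ∩ m₂(L₂) ⊆ m₁(K₁) ∩ m₂(K₂)`, for nodes and for edges. -/
def ParallelIndependent (p₁ p₂ : Rule.{a, b} TG) (G : TypedGraph.{a, b} TG)
    (m₁ : p₁.L ⟶ G) (m₂ : p₂.L ⟶ G) : Prop :=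
  Set.range (itemMap m₁) ∩ Set.range (itemMap m₂) ⊆
    Set.range (itemMap (p₁.l ≫ m₁)) ∩ Set.range (itemMap (p₂.l ≫ m₂))

/-- `P₁ ⟸ G ⟹ P₂` (by `p₁, m₁` and `p₂, m₂`) is a critical GTS pair. -/
structure IsCriticalPair (p₁ p₂ : Rule.{a, b} TG) (G P₁ P₂ : TypedGraph.{a, b} TG)
    (m₁ : p₁.L ⟶ G) (m₂ : p₂.L ⟶ G) : Prop where
  left : DirectTransformation p₁ G P₁ m₁
  right : DirectTransformation p₂ G P₂ m₂
  dependent : ¬ ParallelIndependent p₁ p₂ G m₁ m₂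
  jointly_surjective : Set.range (itemMap m₁) ∪ Set.range (itemMap m₂) = Set.univ

end

end GTS

/-! ## Constraint handling rules -/

namespace CHR

/-- The function symbols every constraint theory has to provide: integer constants, `+`, `-`. -/
inductive ArithFunc : ℕ → Type
  | const (c : ℤ) : ArithFunc 0
  | plus : ArithFunc 2
  | minus : ArithFunc 2

/-- The language of elementary arithmetic. -/
def arith : FirstOrder.Language.{0, 0} := ⟨ArithFunc, fun _ => Empty⟩

/-- The language of the built-in constraints: arithmetic together with arbitrary further function
symbols and built-in predicate symbols (those of `Lx`). -/
abbrev Lang (Lx : FirstOrder.Language.{u, v}) : FirstOrder.Language.{u, v} := arith.sum Lx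

/-- The models of a constraint theory. -/
abbrev Model {Lx : FirstOrder.Language.{u, v}} (CT : (Lang Lx).Theory) : Type _ :=
  FirstOrder.Language.Theory.ModelType.{u, v, max u v} CT

section

variable {Lx : FirstOrder.Language.{u, v}} {Var : Type w}

/-- An integer constant as a term. -/
def cst (c : ℤ) : (Lang Lx).Term Var :=
  FirstOrder.Language.Term.func (L := Lang Lx) (Sum.inl (ArithFunc.const c)) ![]

/-- The term `s + t`. -/
def plusT (s t : (Lang Lx).Term Var) : (Lang Lx).Term Var :=
  FirstOrder.Language.Term.func (L := Lang Lx) (Sum.inl ArithFunc.plus) ![s, t]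

/-- The term `s - t`. -/
def minusT (s t : (Lang Lx).Term Var) : (Lang Lx).Term Var :=
  FirstOrder.Language.Term.func (L := Lang Lx) (Sum.inl ArithFunc.minus) ![s, t]

open Classical in
/-- The variables occurring in a term. -/
noncomputable def termVars (t : (Lang Lx).Term Var) : Set Var := ↑t.varFinset

open Classical in
/-- The term `s[x/t]`. -/
noncomputable def substTerm (x : Var) (t s : (Lang Lx).Term Var) : (Lang Lx).Term Var :=
  s.subst (fun y => if y = x then t else FirstOrder.Language.Term.var y)

/-- All function symbols occurring in the term belong to `F`. -/
def BuiltFrom (F : Set (Σ n, (Lang Lx).Functions n)) : (Lang Lx).Term Var → Prop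
  | .var _ => True
  | .func f ts => ⟨_, f⟩ ∈ F ∧ ∀ i, BuiltFrom F (ts i)

/-- The requirements on a constraint theory `CT`: it contains Clark's equality theory for a set `F`
of (free) function symbols, among them the integer constants, and it evaluates `+` and `-` on
integers. Symbols outside `F` may be interpreted in any way; `=` is the equality of first-order
logic. -/
structure IsConstraintTheory (CT : (Lang Lx).Theory)
    (F : Set (Σ n, (Lang Lx).Functions n)) : Prop where
  const_mem : ∀ c : ℤ, ⟨0, Sum.inl (ArithFunc.const c)⟩ ∈ F
  injective : ∀ (M : Model CT) (n : ℕ) (f : (Lang Lx).Functions n), ⟨n, f⟩ ∈ F →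
    ∀ x y : Fin n → M,
      FirstOrder.Language.Structure.funMap f x = FirstOrder.Language.Structure.funMap f y → x = y
  distinct : ∀ (M : Model CT) (n m : ℕ) (f : (Lang Lx).Functions n)
    (g : (Lang Lx).Functions m), ⟨n, f⟩ ∈ F → ⟨m, g⟩ ∈ F →
    (⟨n, f⟩ : Σ n, (Lang Lx).Functions n) ≠ ⟨m, g⟩ →
    ∀ (x : Fin n → M) (y : Fin m → M),
      FirstOrder.Language.Structure.funMap f x ≠ FirstOrder.Language.Structure.funMap g y
  acyclic : ∀ (M : Model CT) (t : (Lang Lx).Term ℕ) (x : ℕ), BuiltFrom F t →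
    x ∈ termVars t → t ≠ FirstOrder.Language.Term.var x → ∀ ρ : ℕ → M, ρ x ≠ t.realize ρ
  eval_plus : ∀ (M : Model CT) (c d : ℤ) (ρ : ℕ → M),
    (plusT (cst c) (cst d) : (Lang Lx).Term ℕ).realize ρ =
      (cst (c + d) : (Lang Lx).Term ℕ).realize ρ
  eval_minus : ∀ (M : Model CT) (c d : ℤ) (ρ : ℕ → M),
    (minusT (cst c) (cst d) : (Lang Lx).Term ℕ).realize ρ =
      (cst (c - d) : (Lang Lx).Term ℕ).realize ρ

end

/-- A signature of user-defined constraint symbols with their arities. -/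
structure Sig : Type (a + 1) where
  Sym : Type a
  arity : Sym → ℕ

/-- A user-defined constraint `c(t₁, …, tₙ)`. -/
structure User (S : Sig.{a}) (Lx : FirstOrder.Language.{u, v}) (Var : Type w) where
  sym : S.Sym
  args : Fin (S.arity sym) → (Lang Lx).Term Var

/-- An (atomic) built-in constraint. -/
inductive Builtin (Lx : FirstOrder.Language.{u, v}) (Var : Type w)
  | top : Builtin Lx Var
  | bot : Builtin Lx Var
  | eq (s t : (Lang Lx).Term Var) : Builtin Lx Var
  | rel {n : ℕ} (R : (Lang Lx).Relations n) (ts : Fin n → (Lang Lx).Term Var) : Builtin Lx Var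

/-- A goal: a multiset of user-defined constraints. -/
abbrev Goal (S : Sig.{a}) (Lx : FirstOrder.Language.{u, v}) (Var : Type w) :=
  Multiset (User S Lx Var)

/-- A conjunction of built-in constraints, as the multiset of its conjuncts; `∧` is `+`, and the
empty conjunction is `⊤`. -/
abbrev Store (Lx : FirstOrder.Language.{u, v}) (Var : Type w) := Multiset (Builtin Lx Var)

/-- A CHR state: goal, built-in store, global variables. -/
structure State (S : Sig.{a}) (Lx : FirstOrder.Language.{u, v}) (Var : Type w) where
  goal : Goal S Lx Var
  store : Store Lx Var
  globals : Set Var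

section

variable {S : Sig.{a}} {Lx : FirstOrder.Language.{u, v}} {Var : Type w}

/-- Variables of a user-defined constraint. -/
def User.vars (c : User S Lx Var) : Set Var := ⋃ i, termVars (c.args i)

/-- Variables of a built-in constraint. -/
def Builtin.vars : Builtin Lx Var → Set Var
  | .top => ∅
  | .bot => ∅
  | .eq s t => termVars s ∪ termVars t
  | .rel _ ts => ⋃ i, termVars (ts i)

/-- Variables of a goal. -/
def goalVars (𝔾 : Goal S Lx Var) : Set Var := {x | ∃ c ∈ 𝔾, x ∈ c.vars}

/-- Variables of a conjunction of built-in constraints. -/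
def storeVars (𝔹 : Store Lx Var) : Set Var := {x | ∃ c ∈ 𝔹, x ∈ c.vars}

/-- The constraint `c[x/t]`. -/
noncomputable def User.subst (x : Var) (t : (Lang Lx).Term Var) (c : User S Lx Var) :
    User S Lx Var :=
  ⟨c.sym, fun i => substTerm x t (c.args i)⟩

/-- Renaming of variables in a user-defined constraint. -/
def User.rename (ρ : Var → Var) (c : User S Lx Var) : User S Lx Var :=
  ⟨c.sym, fun i => (c.args i).relabel ρ⟩

/-- Renaming of variables in a built-in constraint. -/
def Builtin.rename (ρ : Var → Var) : Builtin Lx Var → Builtin Lx Var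
  | .top => .top
  | .bot => .bot
  | .eq s t => .eq (s.relabel ρ) (t.relabel ρ)
  | .rel R ts => .rel R (fun i => (ts i).relabel ρ)

/-- Truth of a built-in constraint under a valuation `η` in a structure. -/
def Builtin.Holds {M : Type*} [(Lang Lx).Structure M] (η : Var → M) : Builtin Lx Var → Prop
  | .top => True
  | .bot => False
  | .eq s t => s.realize η = t.realize η
  | .rel R ts => FirstOrder.Language.Structure.RelMap R (fun i => (ts i).realize η)

/-- Truth of a conjunction of built-in constraints under a valuation. -/
def storeHolds {M : Type*} [(Lang Lx).Structure M] (η : Var → M) (𝔹 : Store Lx Var) : Prop :=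
  ∀ c ∈ 𝔹, c.Holds η

/-- `CT ⊨ ∃ 𝔹`. -/
def Satisfiable (CT : (Lang Lx).Theory) (𝔹 : Store Lx Var) : Prop :=
  ∀ M : Model CT, ∃ η : Var → M, storeHolds η 𝔹

/-- `CT ⊨ (∃ s̄. 𝔹) ↔ (∃ s̄'. 𝔹')`, where `W` is the set of the variables that are not quantified
existentially. -/
def EntailsIff (CT : (Lang Lx).Theory) (W : Set Var) (𝔹 𝔹' : Store Lx Var) : Prop :=
  ∀ (M : Model CT) (η : Var → M),
    (∃ η' : Var → M, Set.EqOn η' η W ∧ storeHolds η' 𝔹) ↔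
      (∃ η' : Var → M, Set.EqOn η' η W ∧ storeHolds η' 𝔹')

/-- The four conditions that generate state equivalence. -/
inductive EquivStep (CT : (Lang Lx).Theory) : State S Lx Var → State S Lx Var → Prop
  /-- Substitution. -/
  | subst (𝔾 : Goal S Lx Var) (x : Var) (t : (Lang Lx).Term Var) (𝔹 : Store Lx Var)
      (𝕍 : Set Var) :
      EquivStep CT ⟨𝔾, Builtin.eq (.var x) t ::ₘ 𝔹, 𝕍⟩
        ⟨𝔾.map (User.subst x t), Builtin.eq (.var x) t ::ₘ 𝔹, 𝕍⟩
  /-- Transformation of the constraint store; the strictly local variables are those outside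
  `𝕍 ∪ vars(𝔾)`. -/
  | transform (𝔾 : Goal S Lx Var) (𝔹 𝔹' : Store Lx Var) (𝕍 : Set Var)
      (h : EntailsIff CT (𝕍 ∪ goalVars 𝔾) 𝔹 𝔹') :
      EquivStep CT ⟨𝔾, 𝔹, 𝕍⟩ ⟨𝔾, 𝔹', 𝕍⟩
  /-- Omission of non-occurring global variables. -/
  | omitGlobal (𝔾 : Goal S Lx Var) (𝔹 : Store Lx Var) (𝕍 : Set Var) (x : Var)
      (hG : x ∉ goalVars 𝔾) (hB : x ∉ storeVars 𝔹) :
      EquivStep CT ⟨𝔾, 𝔹, insert x 𝕍⟩ ⟨𝔾, 𝔹, 𝕍⟩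
  /-- Equivalence of failed states. -/
  | failed (𝔾 𝔾' : Goal S Lx Var) (𝕍 : Set Var) :
      EquivStep CT ⟨𝔾, {Builtin.bot}, 𝕍⟩ ⟨𝔾', {Builtin.bot}, 𝕍⟩

/-- State equivalence: the smallest equivalence relation satisfying the four conditions. -/
def StateEquiv (CT : (Lang Lx).Theory) (σ τ : State S Lx Var) : Prop :=
  Relation.EqvGen (EquivStep CT) σ τ

end

/-- A simplification rule without guard, `head ⇔ bodyU, bodyB`. -/
structure Rule (S : Sig.{a}) (Lx : FirstOrder.Language.{u, v}) (Var : Type w) where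
  head : Goal S Lx Var
  bodyU : Goal S Lx Var
  bodyB : Store Lx Var

section

variable {S : Sig.{a}} {Lx : FirstOrder.Language.{u, v}} {Var : Type w}

/-- Variables of a rule. -/
def Rule.vars (r : Rule S Lx Var) : Set Var :=
  goalVars r.head ∪ goalVars r.bodyU ∪ storeVars r.bodyB

/-- Renaming of variables in a rule. -/
def Rule.rename (ρ : Var → Var) (r : Rule S Lx Var) : Rule S Lx Var :=
  ⟨r.head.map (User.rename ρ), r.bodyU.map (User.rename ρ), r.bodyB.map (Builtin.rename ρ)⟩

open Classical in
/-- The built-in constraints expressing `c = d`: equality of corresponding arguments if the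
constraint symbols agree, `⊥` otherwise. -/
noncomputable def eqUser (c d : User S Lx Var) : Store Lx Var :=
  if h : c.sym = d.sym then
    (Finset.univ : Finset (Fin (S.arity c.sym))).val.map
      (fun i => Builtin.eq (c.args i) (d.args (Fin.cast (congrArg S.arity h) i)))
  else {Builtin.bot}

/-- An overlap of two rules: the rules are renamed apart, their heads are split into `H₁ ⊎ A₁` and
`H₂ ⊎ A₂` with non-empty `A₁` and `A₂`, and the constraints of `A₁` are equated with those of `A₂`
one by one. `A` is the multiset of the equated pairs, so `A₁` and `A₂` are its two projections. -/
structure Overlap (CT : (Lang Lx).Theory) (r₁ r₂ : Rule S Lx Var) where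
  ρ₁ : Equiv.Perm Var
  ρ₂ : Equiv.Perm Var
  renamed_apart : Disjoint (r₁.rename ρ₁).vars (r₂.rename ρ₂).vars
  H₁ : Goal S Lx Var
  H₂ : Goal S Lx Var
  A : Multiset (User S Lx Var × User S Lx Var)
  head₁ : (r₁.rename ρ₁).head = H₁ + A.map Prod.fst
  head₂ : (r₂.rename ρ₂).head = H₂ + A.map Prod.snd
  nonempty : A ≠ 0
  satisfiable : Satisfiable CT (A.bind fun q => eqUser q.1 q.2)

namespace Overlap

variable {CT : (Lang Lx).Theory} {r₁ r₂ : Rule S Lx Var} (o : Overlap CT r₁ r₂)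

/-- `A₁ = A₂` as a built-in store. -/
noncomputable def eqs : Store Lx Var := o.A.bind fun q => eqUser q.1 q.2

/-- `𝕍 = vars(H₁ ⊎ A₁ ⊎ H₂ ⊎ A₂)`. -/
def globals : Set Var :=
  goalVars (o.H₁ + o.A.map Prod.fst + o.H₂ + o.A.map Prod.snd)

/-- The overlap state `⟨H₁ ⊎ A₁ ⊎ H₂; A₁ = A₂; 𝕍⟩`. -/
noncomputable def state : State S Lx Var :=
  ⟨o.H₁ + o.A.map Prod.fst + o.H₂, o.eqs, o.globals⟩

/-- The first component `⟨B₁ᵘ ⊎ H₂; B₁ᵇ ∧ A₁ = A₂; 𝕍⟩` of the critical pair. -/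
noncomputable def left : State S Lx Var :=
  ⟨(r₁.rename o.ρ₁).bodyU + o.H₂, (r₁.rename o.ρ₁).bodyB + o.eqs, o.globals⟩

/-- The second component `⟨B₂ᵘ ⊎ H₁; B₂ᵇ ∧ A₁ = A₂; 𝕍⟩` of the critical pair. -/
noncomputable def right : State S Lx Var :=
  ⟨(r₂.rename o.ρ₂).bodyU + o.H₁, (r₂.rename o.ρ₂).bodyB + o.eqs, o.globals⟩

end Overlap

end

end CHR

/-! ## The encoding of graph transformation systems -/

namespace Encoding

open GTS CHR

/-- The constraint symbols for a type graph: `τ/2` for each node and `τ/3` for each edge. -/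
def sig (TG : Graph.{a}) : Sig.{a} := ⟨TG.V ⊕ TG.E, Sum.elim (fun _ => 2) (fun _ => 3)⟩

/-- The two ways to encode a node: with explicit degree (`gnd`) or with a degree variable (`kp`). -/
inductive Mode
  | gnd
  | kp

/-- The mappings `var` and `dvar`: all the identifier and degree variables are different. -/
structure VarMap (X : Type b) (Var : Type w) where
  var : X → Var
  dvar : X → Var
  injective : Function.Injective (Sum.elim var dvar)

section

variable {TG : Graph.{a}} {Lx : FirstOrder.Language.{u, v}} {Var : Type w}

/-- The node constraint `τ(s, d)`. -/
def nodeC (τ : TG.V) (s d : (Lang Lx).Term Var) : User (sig TG) Lx Var := ⟨Sum.inl τ, ![s, d]⟩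

/-- The edge constraint `τ(e, s, t)`. -/
def edgeC (τ : TG.E) (e s t : (Lang Lx).Term Var) : User (sig TG) Lx Var :=
  ⟨Sum.inr τ, ![e, s, t]⟩

/-- The encoding of an item of a typed graph. -/
noncomputable def chr (G : TypedGraph.{a, b} TG) (var dvar : G.Item → Var) :
    Mode → G.Item → User (sig TG) Lx Var
  | .gnd, .inl x => nodeC (G.typ.onV x) (.var (var (.inl x))) (cst (G.deg x))
  | .kp, .inl x => nodeC (G.typ.onV x) (.var (var (.inl x))) (.var (dvar (.inl x)))
  | _, .inr e => edgeC (G.typ.onE e) (.var (var (.inr e)))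
      (.var (var (.inl (G.src e)))) (.var (var (.inl (G.tgt e))))

/-- The encoding of a whole typed graph. -/
noncomputable def chrGraph (E : Mode) (G : TypedGraph.{a, b} TG) (ν : VarMap G.Item Var) :
    Goal (sig TG) Lx Var :=
  (Finset.univ : Finset G.Item).val.map (chr G ν.var ν.dvar E)

/-- The items that get variables in the encoding of a rule: those of `L` (which contain those of
`K`), those of `R \ K`, and a copy `v'` of each node `v` of `K`. -/
abbrev RuleItem (p : GTS.Rule.{a, b} TG) : Type b :=
  p.L.Item ⊕ {x : p.R.Item // x ∉ Set.range (itemMap p.r)} ⊕ p.K.V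

open Classical in
/-- The items of `R`, those of `K` being identified with items of `L`. -/
noncomputable def ofR (p : GTS.Rule.{a, b} TG) (x : p.R.Item) : RuleItem p :=
  if h : x ∈ Set.range (itemMap p.r) then .inl (itemMap p.l h.choose) else .inr (.inl ⟨x, h⟩)

open Classical in
/-- The CHR simplification rule that encodes the graph production rule `p`. -/
noncomputable def encode (p : GTS.Rule.{a, b} TG) (ν : VarMap (RuleItem p) Var) :
    CHR.Rule (sig TG) Lx Var where
  head :=
    (Finset.univ : Finset p.K.Item).val.map
      (fun x => chr p.L (ν.var ∘ .inl) (ν.dvar ∘ .inl) .kp (itemMap p.l x)) +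
    (Finset.univ : Finset {x : p.L.Item // x ∉ Set.range (itemMap p.l)}).val.map
      (fun x => chr p.L (ν.var ∘ .inl) (ν.dvar ∘ .inl) .gnd x.1)
  bodyU :=
    (Finset.univ : Finset {x : p.R.Item // x ∉ Set.range (itemMap p.r)}).val.map
      (fun x => chr p.R (ν.var ∘ ofR p) (ν.dvar ∘ ofR p) .gnd x.1) +
    (Finset.univ : Finset p.K.E).val.map
      (fun e => chr p.R (ν.var ∘ ofR p) (ν.dvar ∘ ofR p) .kp (.inr (edgeMap p.r e))) +
    (Finset.univ : Finset p.K.V).val.map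
      (fun x => nodeC (p.K.typ.onV x) (.var (ν.var (.inr (.inr x))))
        (.var (ν.dvar (.inr (.inr x)))))
  bodyB :=
    (Finset.univ : Finset p.K.V).val.bind fun x =>
      {Builtin.eq (.var (ν.var (.inl (.inl (nodeMap p.l x))))) (.var (ν.var (.inr (.inr x)))),
        Builtin.eq (.var (ν.dvar (.inr (.inr x))))
          (plusT (minusT (.var (ν.dvar (.inl (.inl (nodeMap p.l x)))))
            (cst (p.L.deg (nodeMap p.l x)))) (cst (p.R.deg (nodeMap p.r x))))}

/-- Constraints of the form `X = c` for a variable `X` and a constant `c`. -/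
def IsConstEq (β : Builtin Lx Var) : Prop :=
  ∃ (x : Var) (c : ℤ), β = .eq (.var x) (cst c)

/-- Constraints of the form `X = Y + c₁ - c₂`, in either order of the two adjustments; for
`c₁ = c₂ = 0` also written `X = Y`. -/
def IsAdjustment (β : Builtin Lx Var) : Prop :=
  ∃ (x y : Var), β = .eq (.var x) (.var y) ∨ ∃ c₁ c₂ : ℤ,
    β = .eq (.var x) (minusT (plusT (.var y) (cst c₁)) (cst c₂)) ∨
      β = .eq (.var x) (plusT (minusT (.var y) (cst c₂)) (cst c₁))

/-- `σ` is a `𝒢`-state based on `G`. States are identified up to state equivalence, so `σ` may be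
replaced by an equivalent state `⟨𝔾; 𝔹; 𝕍⟩` with a store of the required form. -/
def IsGStateBasedOn (CT : (Lang Lx).Theory) (σ : State (sig TG) Lx Var)
    (G : TypedGraph.{a, b} TG) : Prop :=
  ∃ (𝔾 : Goal (sig TG) Lx Var) (𝔹 : Store Lx Var) (𝕍 : Set Var),
    StateEquiv CT σ ⟨𝔾, 𝔹, 𝕍⟩ ∧ (∀ β ∈ 𝔹, IsConstEq β ∨ IsAdjustment β) ∧
      ∃ (B : Store Lx Var) (ν : VarMap G.Item Var), (∀ β ∈ B, IsConstEq β) ∧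
        StateEquiv CT ⟨𝔾, 𝔹 + B, ∅⟩ ⟨chrGraph .gnd G ν, 0, ∅⟩

end

end Encoding

/-! ## Substitutions and solved stores -/

namespace CHR

section Terms

variable {S : Sig.{a}} {Lx : FirstOrder.Language.{u, v}} {Var : Type w}

open FirstOrder.Language

/-! The overlap equates the head constraints of exactly those pairs of items of the two left-hand
sides that have the same image in `G`; since parallel independence fails, there is such a pair. As
grounding constraints one takes `degStore`, which sets the degree variable of each preserved node to
the degree of its image in `G`. Given these, both degree arguments of a matched pair denote the
degree of the common image. This includes deleted nodes, where the degree in the left-hand side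
already is the degree in `G` because no edge outside the match can touch them
(`IsSquare.deg_of_notMem`). What remains of the equations is that identifiers of items with the same
image agree (`storeHolds_matchedEqs_iff`).

A store that says just "identifiers of one class are equal, degree variables have these values" can
be solved, substituted into the goal and dropped (`stateEquiv_of_classes`). For the overlap state
the classes are items of `G`, and by joint surjectivity the goal becomes one ground constraint per
item of `G`.

For the first component of the critical pair, the body adds the equations for the copies of
preserved nodes. Counting incident edges in the two pushouts gives `deg G + deg K = deg L + deg D`
and `deg P + deg K = deg R + deg D` (`IsSquare.deg_add`), so the updated degree variables receive
exactly the degrees in the result. The items of the result are the created ones, the preserved ones,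
and those of `G` outside the match (`bijective_result_items`); these are the items that the new goal
encodes, with identifiers named after their origin (`exists_origin`). The second component follows
by exchanging the two rules.

The categorical input is confined to `isSquare_of_isPushout`, which turns a pushout along injective
morphisms into elementwise statements on nodes and edges. -/

@[simp] theorem termVars_var (x : Var) : termVars (Lx := Lx) (Term.var x) = {x} := by
  simp [termVars, Term.varFinset]

@[simp] theorem termVars_func {n : ℕ} (f : (Lang Lx).Functions n)
    (ts : Fin n → (Lang Lx).Term Var) :
    termVars (Term.func f ts) = ⋃ i, termVars (ts i) := by
  ext x
  simp [termVars, Term.varFinset]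

theorem termVars_finite (t : (Lang Lx).Term Var) : (termVars t).Finite :=
  Finset.finite_toSet _

theorem subst_congr {f g : Var → (Lang Lx).Term Var} (t : (Lang Lx).Term Var)
    (h : ∀ x ∈ termVars t, f x = g x) : t.subst f = t.subst g := by
  induction t with
  | var x => exact h x (by simp)
  | func F ts ih =>
    simp only [Term.subst]
    congr 1
    funext i
    exact ih i fun x hx => h x (by simpa using ⟨i, hx⟩)

theorem subst_var_self (t : (Lang Lx).Term Var) : t.subst Term.var = t := by
  induction t with
  | var x => rfl
  | func F ts ih => simp only [Term.subst, ih]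

theorem subst_subst (f g : Var → (Lang Lx).Term Var) (t : (Lang Lx).Term Var) :
    (t.subst f).subst g = t.subst fun x => (f x).subst g := by
  induction t with
  | var x => rfl
  | func F ts ih => simp only [Term.subst, ih]

theorem mem_termVars_subst {f : Var → (Lang Lx).Term Var} {t : (Lang Lx).Term Var} {y : Var}
    (h : y ∈ termVars (t.subst f)) : ∃ x ∈ termVars t, y ∈ termVars (f x) := by
  induction t with
  | var x => exact ⟨x, by simp, h⟩
  | func F ts ih =>
    simp only [Term.subst, termVars_func, Set.mem_iUnion] at h ⊢
    obtain ⟨i, hi⟩ := h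
    obtain ⟨x, hx, hy⟩ := ih i hi
    exact ⟨x, ⟨i, hx⟩, hy⟩

theorem mem_termVars_relabel {ρ : Var → Var} {t : (Lang Lx).Term Var} {y : Var}
    (h : y ∈ termVars (t.relabel ρ)) : y ∈ ρ '' termVars t := by
  induction t with
  | var x => simpa using h
  | func F ts ih =>
    simp only [Term.relabel, termVars_func, Set.mem_iUnion] at h
    obtain ⟨i, hi⟩ := h
    obtain ⟨x, hx, hy⟩ := ih i hi
    exact ⟨x, by simpa using ⟨i, hx⟩, hy⟩

theorem realize_congr {M : Type*} [(Lang Lx).Structure M] {η η' : Var → M}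
    (t : (Lang Lx).Term Var) (h : ∀ x ∈ termVars t, η x = η' x) :
    t.realize η = t.realize η' := by
  induction t with
  | var x => exact h x (by simp)
  | func F ts ih =>
    simp only [Term.realize]
    congr 1
    funext i
    exact ih i fun x hx => h x (by simpa using ⟨i, hx⟩)

/-- Simultaneous substitution in a user-defined constraint. -/
def User.bind (θ : Var → (Lang Lx).Term Var) (c : User S Lx Var) : User S Lx Var :=
  ⟨c.sym, fun i => (c.args i).subst θ⟩

theorem goalVars_finite (𝔾 : Goal S Lx Var) : (goalVars 𝔾).Finite := by
  have : goalVars 𝔾 = ⋃ c ∈ {c | c ∈ 𝔾}, c.vars := by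
    ext x
    simp [goalVars]
  rw [this]
  refine Set.Finite.biUnion (Multiset.finite_toSet 𝔾) fun c _ => ?_
  exact Set.finite_iUnion fun i => termVars_finite _

theorem Builtin.vars_finite (β : Builtin Lx Var) : β.vars.Finite := by
  cases β with
  | top => exact Set.finite_empty
  | bot => exact Set.finite_empty
  | eq s t => exact (termVars_finite s).union (termVars_finite t)
  | rel R ts => exact Set.finite_iUnion fun i => termVars_finite _

theorem storeVars_finite (𝔹 : Store Lx Var) : (storeVars 𝔹).Finite := by
  have : storeVars 𝔹 = ⋃ c ∈ {c | c ∈ 𝔹}, c.vars := by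
    ext x
    simp [storeVars]
  rw [this]
  exact Set.Finite.biUnion (Multiset.finite_toSet 𝔹) fun c _ => c.vars_finite

theorem Rule.vars_finite (r : Rule S Lx Var) : r.vars.Finite :=
  ((goalVars_finite _).union (goalVars_finite _)).union (storeVars_finite _)

theorem User.vars_rename (ρ : Var → Var) (c : User S Lx Var) :
    (c.rename ρ).vars ⊆ ρ '' c.vars := by
  intro y hy
  simp only [User.vars, Set.mem_iUnion] at hy
  obtain ⟨i, hi⟩ := hy
  obtain ⟨x, hx, rfl⟩ := mem_termVars_relabel hi
  exact ⟨x, Set.mem_iUnion.2 ⟨i, hx⟩, rfl⟩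

theorem Builtin.vars_rename (ρ : Var → Var) (β : Builtin Lx Var) :
    (β.rename ρ).vars ⊆ ρ '' β.vars := by
  cases β with
  | top => exact fun y hy => hy.elim
  | bot => exact fun y hy => hy.elim
  | eq s t =>
    rintro y (hy | hy)
    · obtain ⟨x, hx, rfl⟩ := mem_termVars_relabel hy
      exact ⟨x, Or.inl hx, rfl⟩
    · obtain ⟨x, hx, rfl⟩ := mem_termVars_relabel hy
      exact ⟨x, Or.inr hx, rfl⟩
  | rel R ts =>
    intro y hy
    obtain ⟨i, hi⟩ := Set.mem_iUnion.1 hy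
    obtain ⟨x, hx, rfl⟩ := mem_termVars_relabel hi
    exact ⟨x, Set.mem_iUnion.2 ⟨i, hx⟩, rfl⟩

theorem goalVars_rename (ρ : Var → Var) (𝔾 : Goal S Lx Var) :
    goalVars (𝔾.map (User.rename ρ)) ⊆ ρ '' goalVars 𝔾 := by
  rintro y ⟨c', hc', hy⟩
  obtain ⟨c, hc, rfl⟩ := Multiset.mem_map.1 hc'
  obtain ⟨x, hx, rfl⟩ := User.vars_rename ρ c hy
  exact ⟨x, ⟨c, hc, hx⟩, rfl⟩

theorem storeVars_rename (ρ : Var → Var) (𝔹 : Store Lx Var) :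
    storeVars (𝔹.map (Builtin.rename ρ)) ⊆ ρ '' storeVars 𝔹 := by
  rintro y ⟨c', hc', hy⟩
  obtain ⟨c, hc, rfl⟩ := Multiset.mem_map.1 hc'
  obtain ⟨x, hx, rfl⟩ := Builtin.vars_rename ρ c hy
  exact ⟨x, ⟨c, hc, hx⟩, rfl⟩

theorem Rule.vars_rename (ρ : Var → Var) (r : Rule S Lx Var) :
    (r.rename ρ).vars ⊆ ρ '' r.vars := by
  rintro y ((hy | hy) | hy)
  · exact Set.image_mono (fun x hx => Or.inl (Or.inl hx)) (goalVars_rename ρ _ hy)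
  · exact Set.image_mono (fun x hx => Or.inl (Or.inr hx)) (goalVars_rename ρ _ hy)
  · exact Set.image_mono (fun x hx => Or.inr hx) (storeVars_rename ρ _ hy)

/-- In an infinite type, a permutation can move any finite set away from another one. -/
theorem exists_perm_disjoint [Infinite Var] {s t : Set Var} (hs : s.Finite) (ht : t.Finite) :
    ∃ ρ : Equiv.Perm Var, Disjoint t (ρ '' s) := by
  have : Infinite (tᶜ : Set Var) := ht.infinite_compl.to_subtype
  have : Finite s := hs
  let e : s ↪ Var :=
    ((Finite.equivFin s).toEmbedding.trans Fin.valEmbedding).trans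
      ((Infinite.natEmbedding (tᶜ : Set Var)).trans (Function.Embedding.subtype _))
  -- A finite set is smaller than `Var`, so its embedding into the complement of `t` extends to a
  -- permutation.
  obtain ⟨ρ, hρ⟩ := Cardinal.extend_function_of_lt e
    ((Cardinal.lt_aleph0_iff_set_finite.2 hs).trans_le (Cardinal.aleph0_le_mk Var))
    ⟨Equiv.refl _⟩
  refine ⟨ρ, Set.disjoint_right.2 ?_⟩
  rintro _ ⟨x, hx, rfl⟩
  rw [hρ ⟨x, hx⟩]
  exact ((Infinite.natEmbedding (tᶜ : Set Var)) _).2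

/-- A finite type embeds into an infinite one, avoiding a finite set. -/
theorem exists_injective_fresh [Infinite Var] (X : Type*) [Finite X] {t : Set Var}
    (ht : t.Finite) : ∃ f : X → Var, Function.Injective f ∧ ∀ x, f x ∉ t := by
  have : Infinite (tᶜ : Set Var) := ht.infinite_compl.to_subtype
  let e : X ↪ (tᶜ : Set Var) :=
    ((Finite.equivFin X).toEmbedding.trans Fin.valEmbedding).trans
      (Infinite.natEmbedding (tᶜ : Set Var))
  exact ⟨fun x => e x, Subtype.val_injective.comp e.injective, fun x => (e x).2⟩

end Terms

/-! ### Eliminating built-in stores up to state equivalence -/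

section Equiv

variable {S : Sig.{a}} {Lx : FirstOrder.Language.{u, v}} {Var : Type w}
  {CT : (Lang Lx).Theory}

open FirstOrder.Language

theorem storeHolds_add {M : Type*} [(Lang Lx).Structure M] {η : Var → M} {𝔹 𝔹' : Store Lx Var} :
    storeHolds η (𝔹 + 𝔹') ↔ storeHolds η 𝔹 ∧ storeHolds η 𝔹' := by
  simp only [storeHolds, Multiset.mem_add, or_imp, forall_and]

theorem storeHolds_bind {ι : Type*} {M : Type*} [(Lang Lx).Structure M] {η : Var → M}
    {s : Multiset ι} {f : ι → Store Lx Var} :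
    storeHolds η (s.bind f) ↔ ∀ i ∈ s, storeHolds η (f i) := by
  simp only [storeHolds, Multiset.mem_bind]
  grind

/-- Stores with the same solutions in every model of the constraint theory. -/
def StoreEquiv (CT : (Lang Lx).Theory) (𝔹 𝔹' : Store Lx Var) : Prop :=
  ∀ (M : Model CT) (η : Var → M), storeHolds η 𝔹 ↔ storeHolds η 𝔹'

theorem StoreEquiv.stateEquiv {𝔹 𝔹' : Store Lx Var} (h : StoreEquiv CT 𝔹 𝔹')
    (𝔾 : Goal S Lx Var) (𝕍 : Set Var) : StateEquiv CT ⟨𝔾, 𝔹, 𝕍⟩ ⟨𝔾, 𝔹', 𝕍⟩ :=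
  .rel _ _ (.transform _ _ _ _ fun M η => by simp only [h M])

open Classical in
/-- The equations `x = θ(x)` for `x` in a finite set. -/
noncomputable def solvedStore (s : Finset Var) (θ : Var → (Lang Lx).Term Var) : Store Lx Var :=
  s.val.map fun x => Builtin.eq (.var x) (θ x)

theorem storeHolds_solvedStore {M : Type*} [(Lang Lx).Structure M] {η : Var → M}
    {s : Finset Var} {θ : Var → (Lang Lx).Term Var} :
    storeHolds η (solvedStore s θ) ↔ ∀ x ∈ s, η x = (θ x).realize η := by
  simp [storeHolds, solvedStore, Builtin.Holds]

open Classical in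
-- The substitution rule of state equivalence handles one variable at a time, so the variables are
-- treated successively by induction on `s'`. The full solved store stays in place throughout, which
-- keeps every equation available.
theorem stateEquiv_bind_solvedStore (𝔾 : Goal S Lx Var) (s : Finset Var)
    (θ : Var → (Lang Lx).Term Var) (hθ : ∀ x ∈ s, ∀ y ∈ termVars (θ x), y ∉ s) (𝕍 : Set Var)
    (s' : Finset Var) (hs' : s' ⊆ s) :
    StateEquiv CT ⟨𝔾, solvedStore s θ, 𝕍⟩
      ⟨𝔾.map (User.bind fun x => if x ∈ s' then θ x else .var x), solvedStore s θ, 𝕍⟩ := by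
  induction s' using Finset.induction_on with
  | empty =>
    have : (User.bind (S := S) (Lx := Lx) fun x : Var =>
        if x ∈ (∅ : Finset Var) then θ x else .var x) = id := by
      funext c
      have : (fun x : Var => if x ∈ (∅ : Finset Var) then θ x else .var x) = Term.var := by
        funext x
        simp
      simp [User.bind, subst_var_self]
    rw [this, Multiset.map_id]
    exact .refl _
  | insert z s' hz ih =>
    refine (ih fun x hx => hs' (Finset.mem_insert_of_mem hx)).trans _ _ _ ?_
    have hzs : z ∈ s := hs' (Finset.mem_insert_self _ _)
    have hstore : solvedStore s θ =
        Builtin.eq (.var z) (θ z) ::ₘ solvedStore (s.erase z) θ := by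
      unfold solvedStore
      rw [← Multiset.map_cons (fun x => Builtin.eq (Term.var x) (θ x)), Finset.erase_val,
        Multiset.cons_erase hzs]
    -- Successive and simultaneous substitution agree because no `θ x` with `x ∈ s` mentions a
    -- variable of `s`, so replacing `z` later cannot disturb terms already inserted.
    have key : User.bind (S := S) (fun x => if x ∈ insert z s' then θ x else .var x) =
        User.subst z (θ z) ∘ User.bind (fun x => if x ∈ s' then θ x else .var x) := by
      funext c
      simp only [User.bind, User.subst, Function.comp, substTerm, subst_subst]
      congr 1
      funext i
      congr 1
      funext x
      by_cases hx : x ∈ s'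
      · simp only [hx, Finset.mem_insert, or_true, if_true]
        conv_lhs => rw [← subst_var_self (θ x)]
        refine subst_congr _ fun y hy => ?_
        rw [if_neg]
        rintro rfl
        exact hθ x (hs' (Finset.mem_insert_of_mem hx)) y hy hzs
      · by_cases hxz : x = z
        · subst hxz
          simp [hx, Term.subst]
        · simp [hx, hxz, Term.subst]
    rw [key, ← Multiset.map_map, hstore]
    exact .rel _ _ (.subst _ _ _ _ _)

open Classical in
/-- A store whose solutions are parametrised by fresh variables can be applied to the goal and
then dropped. -/
theorem stateEquiv_of_parametrised (𝔾 : Goal S Lx Var) (𝔹 : Store Lx Var) (s : Finset Var)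
    (θ : Var → (Lang Lx).Term Var) (hθs : ∀ x ∈ s, ∀ y ∈ termVars (θ x), y ∉ s)
    (hθG : ∀ x ∈ s, ∀ y ∈ termVars (θ x), y ∉ goalVars 𝔾)
    (h : ∀ (M : Model CT) (η : Var → M),
      storeHolds η 𝔹 ↔ ∃ η' : Var → M, ∀ x ∈ s, η x = (θ x).realize η') :
    StateEquiv CT ⟨𝔾, 𝔹, ∅⟩
      ⟨𝔾.map (User.bind fun x => if x ∈ s then θ x else .var x), 0, ∅⟩ := by
  -- The parameters in the terms `θ x` are strictly local, as they occur neither in the goal nor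
  -- among the (empty) globals; hence they may be revalued by `η'` without changing the goal's
  -- variables.
  have h₁ : StateEquiv CT ⟨𝔾, 𝔹, ∅⟩ ⟨𝔾, solvedStore s θ, ∅⟩ := by
    refine .rel _ _ (.transform _ _ _ _ fun M η => ⟨?_, ?_⟩)
    · rintro ⟨η₁, hη₁, hB⟩
      obtain ⟨η', hη'⟩ := (h M η₁).1 hB
      refine ⟨fun x => if ∃ z ∈ s, x ∈ termVars (θ z) then η' x else η₁ x, ?_, ?_⟩
      · intro x hx
        rw [← hη₁ hx]
        refine if_neg ?_
        rintro ⟨z, hz, hxz⟩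
        exact hθG z hz x hxz (by simpa using hx)
      · refine storeHolds_solvedStore.2 fun x hx => ?_
        have : ¬ ∃ z ∈ s, x ∈ termVars (θ z) := fun ⟨z, hz, hxz⟩ => hθs z hz x hxz hx
        rw [if_neg this, hη' x hx]
        exact realize_congr _ fun y hy => (if_pos ⟨x, hx, hy⟩).symm
    · rintro ⟨η₁, hη₁, hE⟩
      exact ⟨η₁, hη₁, (h M η₁).2 ⟨η₁, storeHolds_solvedStore.1 hE⟩⟩
  refine h₁.trans _ _ _ ((stateEquiv_bind_solvedStore 𝔾 s θ hθs ∅ s subset_rfl).trans _ _ _ ?_)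
  -- After substitution the variables of `s` no longer occur in the goal. They are now strictly
  -- local, and each can be given the value of `θ x`, so the solved store is equivalent to the empty
  -- one.
  refine .rel _ _ (.transform _ _ _ _ fun M η => ⟨?_, ?_⟩)
  · rintro -
    exact ⟨η, fun _ _ => rfl, by simp [storeHolds]⟩
  · rintro -
    refine ⟨fun x => if x ∈ s then (θ x).realize η else η x, ?_, ?_⟩
    · intro y hy
      refine if_neg fun hys => ?_
      simp only [Set.empty_union] at hy
      obtain ⟨c', hc', hy⟩ := hy
      obtain ⟨c, hc, rfl⟩ := Multiset.mem_map.1 hc'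
      obtain ⟨i, hi⟩ := Set.mem_iUnion.1 hy
      obtain ⟨x, hx, hyx⟩ := mem_termVars_subst hi
      by_cases hxs : x ∈ s
      · rw [if_pos hxs] at hyx
        exact hθs x hxs y hyx hys
      · rw [if_neg hxs] at hyx
        have : y = x := by simpa using hyx
        exact hxs (this ▸ hys)
    · refine storeHolds_solvedStore.2 fun x hx => ?_
      rw [if_pos hx]
      exact realize_congr _ fun y hy => (if_neg (hθs x hx y hy)).symm

theorem realize_cst {M : Type*} [(Lang Lx).Structure M] {X Y : Type*} (c : ℤ) (η : X → M)
    (η' : Y → M) :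
    (cst c : (Lang Lx).Term X).realize η = (cst c : (Lang Lx).Term Y).realize η' := by
  simp only [cst, Term.realize]
  congr 1
  funext i
  exact i.elim0

theorem termVars_cst (c : ℤ) : termVars (cst c : (Lang Lx).Term Var) = ∅ :=
  (termVars_func _ _).trans (by simp)

/-- If a store says that identifiers of the same class are equal and that the degree variables
have given values, then it can be eliminated in favour of one fresh variable for each class. -/
theorem stateEquiv_of_classes [Infinite Var] (𝔾 : Goal S Lx Var) (𝔹 : Store Lx Var)
    {J D T : Type*} [Finite J] [Finite D] [Finite T] (idv : J → Var) (dv : D → Var)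
    (hinj : Function.Injective (Sum.elim idv dv)) (cls : J → T) (val : D → ℤ)
    (h : ∀ (M : Model CT) (η : Var → M), storeHolds η 𝔹 ↔
      (∀ i j, cls i = cls j → η (idv i) = η (idv j)) ∧
        ∀ d, η (dv d) = (cst (val d) : (Lang Lx).Term Var).realize η) :
    ∃ (ν : T → Var) (θ : Var → (Lang Lx).Term Var), Function.Injective ν ∧
      (∀ j, θ (idv j) = .var (ν (cls j))) ∧ (∀ d, θ (dv d) = cst (val d)) ∧
        StateEquiv CT ⟨𝔾, 𝔹, ∅⟩ ⟨𝔾.map (User.bind θ), 0, ∅⟩ := by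
  classical
  obtain ⟨ν, hν, hfresh⟩ := exists_injective_fresh (Var := Var) T
    ((Set.finite_range (Sum.elim idv dv)).union (goalVars_finite 𝔾))
  let s : Finset Var := (Set.finite_range (Sum.elim idv dv)).toFinset
  let θ : Var → (Lang Lx).Term Var :=
    Function.extend (Sum.elim idv dv)
      (Sum.elim (fun j => .var (ν (cls j))) (fun d => cst (val d))) Term.var
  have hθi : ∀ j, θ (idv j) = .var (ν (cls j)) := fun j => hinj.extend_apply _ _ (Sum.inl j)
  have hθd : ∀ d, θ (dv d) = cst (val d) := fun d => hinj.extend_apply _ _ (Sum.inr d)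
  have hs : ∀ x, x ∈ s ↔ (∃ j, idv j = x) ∨ ∃ d, dv d = x := by
    intro x
    simp [s]
  have hvars : ∀ x ∈ s, ∀ y ∈ termVars (θ x), ∃ t, y = ν t := by
    intro x hx y hy
    obtain ⟨j, rfl⟩ | ⟨d, rfl⟩ := (hs x).1 hx
    · rw [hθi] at hy
      exact ⟨cls j, by simpa using hy⟩
    · rw [hθd, termVars_cst] at hy
      exact hy.elim
  have hθ : (fun x => if x ∈ s then θ x else .var x) = θ := by
    funext x
    by_cases hx : x ∈ s
    · rw [if_pos hx]
    · rw [if_neg hx]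
      refine (Function.extend_apply' _ _ _ ?_).symm
      simpa [s] using hx
  refine ⟨ν, θ, hν, hθi, hθd, ?_⟩
  have := stateEquiv_of_parametrised (CT := CT) 𝔾 𝔹 s θ ?_ ?_ ?_
  · rwa [hθ] at this
  · intro x hx y hy hys
    obtain ⟨t, rfl⟩ := hvars x hx y hy
    exact hfresh t (Or.inl (by simpa [s] using hys))
  · intro x hx y hy hys
    obtain ⟨t, rfl⟩ := hvars x hx y hy
    exact hfresh t (Or.inr hys)
  · intro M η
    rw [h M η]
    constructor
    · rintro ⟨hi, hd⟩
      have hne : Nonempty M := inferInstance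
      -- The parameter of a class takes the common value of its identifiers; classes without
      -- identifiers get an arbitrary value.
      refine ⟨Function.extend ν (Function.extend cls (η ∘ idv) fun _ => Classical.arbitrary M)
        fun _ => Classical.arbitrary M, fun x hx => ?_⟩
      obtain ⟨j, rfl⟩ | ⟨d, rfl⟩ := (hs x).1 hx
      · rw [hθi, Term.realize, hν.extend_apply]
        have hf : Function.FactorsThrough (η ∘ idv) cls := fun i j hij => hi i j hij
        rw [hf.extend_apply]
        rfl
      · rw [hθd, hd d]
        exact realize_cst _ _ _
    · rintro ⟨η', hη'⟩
      have hi : ∀ j, η (idv j) = η' (ν (cls j)) := fun j => by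
        rw [hη' _ ((hs _).2 (Or.inl ⟨j, rfl⟩)), hθi]
        rfl
      refine ⟨fun i j hij => by rw [hi, hi, hij], fun d => ?_⟩
      rw [hη' _ ((hs _).2 (Or.inr ⟨d, rfl⟩)), hθd]
      exact realize_cst _ _ _

end Equiv

/-! ### Equations between user-defined constraints -/

section Eq

variable {S : Sig.{a}} {Lx : FirstOrder.Language.{u, v}} {Var : Type w}

open FirstOrder.Language

theorem storeHolds_eqUser {M : Type*} [(Lang Lx).Structure M] {η : Var → M} (σ : S.Sym)
    (s t : Fin (S.arity σ) → (Lang Lx).Term Var) :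
    storeHolds η (eqUser (S := S) ⟨σ, s⟩ ⟨σ, t⟩) ↔ ∀ i, (s i).realize η = (t i).realize η := by
  simp [storeHolds, eqUser, Builtin.Holds]

theorem storeHolds_eqUser_comm {M : Type*} [(Lang Lx).Structure M] {η : Var → M}
    (c d : User S Lx Var) :
    storeHolds η (eqUser c d) ↔ storeHolds η (eqUser d c) := by
  obtain ⟨σ, s⟩ := c
  obtain ⟨τ, t⟩ := d
  by_cases h : σ = τ
  · subst h
    simp only [storeHolds_eqUser, eq_comm]
  · simp [eqUser, h, Ne.symm h]

end Eq

end CHR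

/-! ## Pushouts of sets along injective maps -/

namespace GTS

section Glue

variable {K L D T : Type*} (l : K → L) (k : K → D)

/-- The pushout of sets along an injective map `l`. -/
abbrev Glue : Type _ := D ⊕ {x : L // x ∉ Set.range l}

open Classical in
/-- The map from `L` into the pushout. -/
noncomputable def glueMap (x : L) : Glue (D := D) l :=
  if h : x ∈ Set.range l then .inl (k h.choose) else .inr ⟨x, h⟩

variable {l k}

theorem glueMap_apply (hl : Function.Injective l) (y : K) :
    glueMap l k (l y) = .inl (k y) := by
  have h : l y ∈ Set.range l := ⟨y, rfl⟩
  rw [glueMap, dif_pos h, hl h.choose_spec]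

theorem glueMap_eq_inl {x : L} {d : D} (h : glueMap l k x = .inl d) : ∃ y, l y = x ∧ k y = d := by
  unfold glueMap at h
  split_ifs at h with hx
  exact ⟨hx.choose, hx.choose_spec, Sum.inl_injective h⟩

theorem glueMap_injective (hk : Function.Injective k) :
    Function.Injective (glueMap l k) := by
  intro x y h
  unfold glueMap at h
  split_ifs at h with hx hy hy
  · rw [← hx.choose_spec, ← hy.choose_spec, hk (Sum.inl_injective h)]
  · simpa using h

/-- The map out of the pushout. -/
def glueDesc (s : L → T) (t : D → T) : Glue (D := D) l → T := Sum.elim t fun x => s x.1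

theorem glueDesc_glueMap {s : L → T} {t : D → T} (w : ∀ y, s (l y) = t (k y)) (x : L) :
    glueDesc s t (glueMap l k x) = s x := by
  unfold glueMap
  split_ifs with hx
  · exact (w _).symm.trans (congrArg s hx.choose_spec)
  · rfl

end Glue

/-! ## Pushouts of typed graphs along injective morphisms -/

section Square

variable {TG : Graph.{a}} {K L D G : TypedGraph.{a, b} TG}

theorem nodeMap_src {X Y : TypedGraph.{a, b} TG} (f : X ⟶ Y) (e : X.E) :
    nodeMap f (X.src e) = Y.src (edgeMap f e) := TypedGraph.Hom.toHom f |>.src_comm e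

theorem nodeMap_tgt {X Y : TypedGraph.{a, b} TG} (f : X ⟶ Y) (e : X.E) :
    nodeMap f (X.tgt e) = Y.tgt (edgeMap f e) := TypedGraph.Hom.toHom f |>.tgt_comm e

theorem typ_nodeMap {X Y : TypedGraph.{a, b} TG} (f : X ⟶ Y) (x : X.V) :
    Y.typ.onV (nodeMap f x) = X.typ.onV x := TypedGraph.Hom.typV f x

theorem typ_edgeMap {X Y : TypedGraph.{a, b} TG} (f : X ⟶ Y) (x : X.E) :
    Y.typ.onE (edgeMap f x) = X.typ.onE x := TypedGraph.Hom.typE f x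

theorem hom_ext {X Y : TypedGraph.{a, b} TG} {f g : X ⟶ Y} (hV : ∀ x, nodeMap f x = nodeMap g x)
    (hE : ∀ e, edgeMap f e = edgeMap g e) : f = g :=
  TypedGraph.Hom.ext (funext hV) (funext hE)

theorem Inj.itemMap {X Y : TypedGraph.{a, b} TG} {f : X ⟶ Y} (hf : Inj f) :
    Function.Injective (itemMap f) :=
  hf.1.sumMap hf.2

open Classical in
/-- The pushout of typed graphs along an injective morphism. -/
noncomputable def glueGraph (l : K ⟶ L) (k : K ⟶ D) : TypedGraph.{a, b} TG where
  V := Glue (D := D.V) (nodeMap l)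
  E := Glue (D := D.E) (edgeMap l)
  finV := inferInstance
  finE := inferInstance
  src := glueDesc (fun e => glueMap (nodeMap l) (nodeMap k) (L.src e)) fun e => .inl (D.src e)
  tgt := glueDesc (fun e => glueMap (nodeMap l) (nodeMap k) (L.tgt e)) fun e => .inl (D.tgt e)
  typ :=
    { onV := glueDesc L.typ.onV D.typ.onV
      onE := glueDesc L.typ.onE D.typ.onE
      src_comm := by
        rintro (e | e)
        · exact D.typ.src_comm e
        · exact (glueDesc_glueMap (fun y => by rw [typ_nodeMap, typ_nodeMap]) _).trans
            (L.typ.src_comm e.1)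
      tgt_comm := by
        rintro (e | e)
        · exact D.typ.tgt_comm e
        · exact (glueDesc_glueMap (fun y => by rw [typ_nodeMap, typ_nodeMap]) _).trans
            (L.typ.tgt_comm e.1) }

/-- The morphism from `L` into the pushout. -/
noncomputable def glueInl (l : K ⟶ L) (k : K ⟶ D) (hl : Inj l) : L ⟶ glueGraph l k :=
  TypedGraph.Hom.mk
    { onV := glueMap (nodeMap l) (nodeMap k)
      onE := glueMap (edgeMap l) (edgeMap k)
      src_comm := fun e => (glueDesc_glueMap
        (s := fun e => glueMap (nodeMap l) (nodeMap k) (L.src e)) (t := fun e => .inl (D.src e))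
        (fun y => by rw [← nodeMap_src, ← nodeMap_src, glueMap_apply hl.1]) e).symm
      tgt_comm := fun e => (glueDesc_glueMap
        (s := fun e => glueMap (nodeMap l) (nodeMap k) (L.tgt e)) (t := fun e => .inl (D.tgt e))
        (fun y => by rw [← nodeMap_tgt, ← nodeMap_tgt, glueMap_apply hl.1]) e).symm }
    (fun x => glueDesc_glueMap (fun y => by rw [typ_nodeMap, typ_nodeMap]) x)
    (fun x => glueDesc_glueMap (fun y => by rw [typ_edgeMap, typ_edgeMap]) x)

/-- The morphism from `D` into the pushout. -/
noncomputable def glueInr (l : K ⟶ L) (k : K ⟶ D) : D ⟶ glueGraph l k :=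
  TypedGraph.Hom.mk
    { onV := Sum.inl
      onE := Sum.inl
      src_comm := fun _ => rfl
      tgt_comm := fun _ => rfl }
    (fun _ => rfl) (fun _ => rfl)

/-- The union of the images of two morphisms, as a graph of its own. -/
noncomputable def unionGraph (m : L ⟶ G) (f : D ⟶ G) : TypedGraph.{a, b} TG where
  V := {x : G.V // (∃ y, nodeMap m y = x) ∨ ∃ y, nodeMap f y = x}
  E := {x : G.E // (∃ y, edgeMap m y = x) ∨ ∃ y, edgeMap f y = x}
  finV := Fintype.ofFinite _
  finE := Fintype.ofFinite _
  src e := ⟨G.src e.1, by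
    obtain ⟨_, ⟨y, rfl⟩ | ⟨y, rfl⟩⟩ := e
    · exact Or.inl ⟨_, nodeMap_src m y⟩
    · exact Or.inr ⟨_, nodeMap_src f y⟩⟩
  tgt e := ⟨G.tgt e.1, by
    obtain ⟨_, ⟨y, rfl⟩ | ⟨y, rfl⟩⟩ := e
    · exact Or.inl ⟨_, nodeMap_tgt m y⟩
    · exact Or.inr ⟨_, nodeMap_tgt f y⟩⟩
  typ :=
    { onV := fun x => G.typ.onV x.1
      onE := fun x => G.typ.onE x.1
      src_comm := fun e => G.typ.src_comm e.1
      tgt_comm := fun e => G.typ.tgt_comm e.1 }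

/-- The inclusion of the union of two images. -/
noncomputable def unionIncl (m : L ⟶ G) (f : D ⟶ G) : unionGraph m f ⟶ G :=
  TypedGraph.Hom.mk ⟨Subtype.val, Subtype.val, fun _ => rfl, fun _ => rfl⟩
    (fun _ => rfl) (fun _ => rfl)

/-- The first morphism, with values in the union of the images. -/
noncomputable def unionInl (m : L ⟶ G) (f : D ⟶ G) : L ⟶ unionGraph m f :=
  TypedGraph.Hom.mk
    ⟨fun x => ⟨nodeMap m x, Or.inl ⟨x, rfl⟩⟩, fun x => ⟨edgeMap m x, Or.inl ⟨x, rfl⟩⟩,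
      fun e => Subtype.ext (nodeMap_src m e), fun e => Subtype.ext (nodeMap_tgt m e)⟩
    (fun x => typ_nodeMap m x) (fun x => typ_edgeMap m x)

/-- The second morphism, with values in the union of the images. -/
noncomputable def unionInr (m : L ⟶ G) (f : D ⟶ G) : D ⟶ unionGraph m f :=
  TypedGraph.Hom.mk
    ⟨fun x => ⟨nodeMap f x, Or.inr ⟨x, rfl⟩⟩, fun x => ⟨edgeMap f x, Or.inr ⟨x, rfl⟩⟩,
      fun e => Subtype.ext (nodeMap_src f e), fun e => Subtype.ext (nodeMap_tgt f e)⟩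
    (fun x => typ_nodeMap f x) (fun x => typ_edgeMap f x)

/-- A commutative square of injective maps of sets that is both a pushout and a pullback. -/
structure IsBicartesian {K L D G : Type*} (l : K → L) (k : K → D) (m : L → G) (f : D → G) :
    Prop where
  comm : ∀ y, m (l y) = f (k y)
  inj_l : Function.Injective l
  inj_k : Function.Injective k
  inj_m : Function.Injective m
  inj_f : Function.Injective f
  meet : ∀ x d, m x = f d → ∃ y, l y = x ∧ k y = d
  cover : ∀ g, (∃ x, m x = g) ∨ ∃ d, f d = g

theorem IsBicartesian.flip {K L D G : Type*} {l : K → L} {k : K → D} {m : L → G} {f : D → G}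
    (h : IsBicartesian l k m f) : IsBicartesian k l f m where
  comm y := (h.comm y).symm
  inj_l := h.inj_k
  inj_k := h.inj_l
  inj_m := h.inj_f
  inj_f := h.inj_m
  meet d x e := by
    obtain ⟨y, hy, hy'⟩ := h.meet x d e.symm
    exact ⟨y, hy', hy⟩
  cover g := (h.cover g).symm

/-- A pushout square of typed graphs of injective morphisms. -/
structure IsSquare (l : K ⟶ L) (k : K ⟶ D) (m : L ⟶ G) (f : D ⟶ G) : Prop where
  node : IsBicartesian (nodeMap l) (nodeMap k) (nodeMap m) (nodeMap f)
  edge : IsBicartesian (edgeMap l) (edgeMap k) (edgeMap m) (edgeMap f)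

theorem IsSquare.flip {l : K ⟶ L} {k : K ⟶ D} {m : L ⟶ G} {f : D ⟶ G} (h : IsSquare l k m f) :
    IsSquare k l f m :=
  ⟨h.node.flip, h.edge.flip⟩

theorem IsSquare.item {l : K ⟶ L} {k : K ⟶ D} {m : L ⟶ G} {f : D ⟶ G} (h : IsSquare l k m f) :
    IsBicartesian (itemMap l) (itemMap k) (itemMap m) (itemMap f) where
  comm
    | .inl y => congrArg Sum.inl (h.node.comm y)
    | .inr y => congrArg Sum.inr (h.edge.comm y)
  inj_l := h.node.inj_l.sumMap h.edge.inj_l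
  inj_k := h.node.inj_k.sumMap h.edge.inj_k
  inj_m := h.node.inj_m.sumMap h.edge.inj_m
  inj_f := h.node.inj_f.sumMap h.edge.inj_f
  meet
    | .inl x, .inl d, e => by
      obtain ⟨y, rfl, rfl⟩ := h.node.meet x d (Sum.inl_injective e)
      exact ⟨.inl y, rfl, rfl⟩
    | .inr x, .inr d, e => by
      obtain ⟨y, rfl, rfl⟩ := h.edge.meet x d (Sum.inr_injective e)
      exact ⟨.inr y, rfl, rfl⟩
    | .inl _, .inr _, e => by simp [itemMap] at e
    | .inr _, .inl _, e => by simp [itemMap] at e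
  cover
    | .inl g => (h.node.cover g).imp (fun ⟨x, hx⟩ => ⟨.inl x, congrArg Sum.inl hx⟩)
        fun ⟨x, hx⟩ => ⟨.inl x, congrArg Sum.inl hx⟩
    | .inr g => (h.edge.cover g).imp (fun ⟨x, hx⟩ => ⟨.inr x, congrArg Sum.inr hx⟩)
        fun ⟨x, hx⟩ => ⟨.inr x, congrArg Sum.inr hx⟩

/-- Two test cocones suffice. The map from the pushout to `glueGraph` shows that `m` and `f` are
injective and that their images meet only in the image of `K`. The map to `unionGraph`, followed by
the inclusion, is the identity of `G` by uniqueness, so `m` and `f` cover `G`. -/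
theorem isSquare_of_isPushout {l : K ⟶ L} {k : K ⟶ D} {m : L ⟶ G} {f : D ⟶ G} (hl : Inj l)
    (hk : Inj k) (h : IsPushout l k m f) : IsSquare l k m f := by
  have hw : l ≫ glueInl l k hl = k ≫ glueInr l k :=
    hom_ext (fun y => glueMap_apply (k := nodeMap k) hl.1 y)
      (fun y => glueMap_apply (k := edgeMap k) hl.2 y)
  have h₁ : m ≫ h.desc _ _ hw = glueInl l k hl := h.inl_desc _ _ hw
  have h₂ : f ≫ h.desc _ _ hw = glueInr l k := h.inr_desc _ _ hw
  have hu : l ≫ unionInl m f = k ≫ unionInr m f :=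
    hom_ext (fun y => Subtype.ext (congrArg (fun t => nodeMap t y) h.w))
      (fun y => Subtype.ext (congrArg (fun t => edgeMap t y) h.w))
  have hid : h.desc _ _ hu ≫ unionIncl m f = 𝟙 G := by
    refine h.hom_ext ?_ ?_
    · rw [h.inl_desc_assoc, Category.comp_id]
      rfl
    · rw [h.inr_desc_assoc, Category.comp_id]
      rfl
  have e₁V : ∀ x, nodeMap (h.desc _ _ hw) (nodeMap m x) = glueMap (nodeMap l) (nodeMap k) x :=
    fun x => congrArg (fun t : L ⟶ glueGraph l k => nodeMap t x) h₁
  have e₁E : ∀ x, edgeMap (h.desc _ _ hw) (edgeMap m x) = glueMap (edgeMap l) (edgeMap k) x :=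
    fun x => congrArg (fun t : L ⟶ glueGraph l k => edgeMap t x) h₁
  have e₂V : ∀ x, nodeMap (h.desc _ _ hw) (nodeMap f x) = Sum.inl x :=
    fun x => congrArg (fun t => nodeMap t x) h₂
  have e₂E : ∀ x, edgeMap (h.desc _ _ hw) (edgeMap f x) = Sum.inl x :=
    fun x => congrArg (fun t => edgeMap t x) h₂
  refine ⟨⟨fun y => congrArg (fun t => nodeMap t y) h.w, hl.1, hk.1, ?_, ?_, ?_, ?_⟩,
    ⟨fun y => congrArg (fun t => edgeMap t y) h.w, hl.2, hk.2, ?_, ?_, ?_, ?_⟩⟩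
  · intro x y hxy
    exact glueMap_injective hk.1 (by rw [← e₁V, ← e₁V, hxy])
  · intro x y hxy
    exact Sum.inl_injective (by rw [← e₂V, ← e₂V, hxy])
  · intro x d hxd
    exact glueMap_eq_inl (by rw [← e₁V, ← e₂V, hxd])
  · intro g
    have : (nodeMap (h.desc _ _ hu) g).1 = g := congrArg (fun t => nodeMap t g) hid
    simpa only [this] using (nodeMap (h.desc _ _ hu) g).2
  · intro x y hxy
    exact glueMap_injective hk.2 (by rw [← e₁E, ← e₁E, hxy])
  · intro x y hxy
    exact Sum.inl_injective (by rw [← e₂E, ← e₂E, hxy])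
  · intro x d hxd
    exact glueMap_eq_inl (by rw [← e₁E, ← e₂E, hxd])
  · intro g
    have : (edgeMap (h.desc _ _ hu) g).1 = g := congrArg (fun t => edgeMap t g) hid
    simpa only [this] using (edgeMap (h.desc _ _ hu) g).2

/-- Injectivity of `k` is inherited from the match: `k` followed by `f` equals `p.l` followed by
`m`, and the latter two are injective. -/
theorem DirectTransformation.exists_isSquare {p : Rule.{a, b} TG} {G H : TypedGraph.{a, b} TG}
    {m : p.L ⟶ G} (h : DirectTransformation p G H m) :
    ∃ (D : TypedGraph.{a, b} TG) (k : p.K ⟶ D) (f : D ⟶ G) (n : p.R ⟶ H) (g : D ⟶ H),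
      IsSquare p.l k m f ∧ IsSquare p.r k n g := by
  obtain ⟨hm, D, k, f, n, g, h₁, h₂⟩ := h
  have hk : Inj k := by
    have eV : ∀ y, nodeMap m (nodeMap p.l y) = nodeMap f (nodeMap k y) :=
      fun y => congrArg (fun t => nodeMap t y) h₁.w
    have eE : ∀ y, edgeMap m (edgeMap p.l y) = edgeMap f (edgeMap k y) :=
      fun y => congrArg (fun t => edgeMap t y) h₁.w
    exact ⟨fun x y hxy => p.inj_l.1 (hm.1 (by rw [eV, eV, hxy])),
      fun x y hxy => p.inj_l.2 (hm.2 (by rw [eE, eE, hxy]))⟩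
  exact ⟨D, k, f, n, g, isSquare_of_isPushout p.inj_l hk h₁, isSquare_of_isPushout p.inj_r hk h₂⟩

/-! ## Degrees in pushouts -/

section Count

variable {VK VL VD VG EK EL ED EG : Type*}
  {lV : VK → VL} {kV : VK → VD} {mV : VL → VG} {fV : VD → VG}
  {lE : EK → EL} {kE : EK → ED} {mE : EL → EG} {fE : ED → EG}
  {sK : EK → VK} {sL : EL → VL} {sD : ED → VD} {sG : EG → VG}

open Classical in
-- The dangling condition: an edge coming from `D` and incident with `mV x` would put its endpoint
-- into both images, hence `x` into the image of `K`.
theorem IsBicartesian.card_incident_of_notMem [Fintype EL] [Fintype EG]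
    (hV : IsBicartesian lV kV mV fV) (hE : IsBicartesian lE kE mE fE)
    (hm : ∀ e, mV (sL e) = sG (mE e)) (hf : ∀ e, fV (sD e) = sG (fE e))
    {x : VL} (hx : x ∉ Set.range lV) :
    (Finset.univ.filter fun e => sG e = mV x).card =
      (Finset.univ.filter fun e => sL e = x).card := by
  rw [← Finset.card_image_of_injective _ hE.inj_m]
  congr 1
  ext e
  simp only [Finset.mem_filter, Finset.mem_univ, true_and, Finset.mem_image]
  constructor
  · intro he
    obtain ⟨e, rfl⟩ | ⟨e, rfl⟩ := hE.cover e
    · exact ⟨e, hV.inj_m (by rw [hm, he]), rfl⟩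
    · obtain ⟨y, hy, -⟩ := hV.meet x (sD e) (by rw [hf, he])
      exact absurd ⟨y, hy⟩ hx
  · rintro ⟨e, rfl, rfl⟩
    exact (hm e).symm

open Classical in
-- Inclusion–exclusion: the edges of `G` at a preserved node are those from `L` together with those
-- from `D`, and the overlap of the two sets consists of those from `K`. The maps `sK`, `sL`, `sD`,
-- `sG` stand for the sources or for the targets, so that a degree is the sum of two instances.
theorem IsBicartesian.card_incident [Fintype EK] [Fintype EL] [Fintype ED] [Fintype EG]
    (hV : IsBicartesian lV kV mV fV) (hE : IsBicartesian lE kE mE fE)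
    (hl : ∀ e, lV (sK e) = sL (lE e)) (hk : ∀ e, kV (sK e) = sD (kE e))
    (hm : ∀ e, mV (sL e) = sG (mE e)) (hf : ∀ e, fV (sD e) = sG (fE e))
    (y : VK) :
    (Finset.univ.filter fun e => sG e = mV (lV y)).card +
        (Finset.univ.filter fun e => sK e = y).card =
      (Finset.univ.filter fun e => sL e = lV y).card +
        (Finset.univ.filter fun e => sD e = kV y).card := by
  rw [← Finset.card_image_of_injective (Finset.univ.filter fun e => sL e = lV y) hE.inj_m,
    ← Finset.card_image_of_injective (Finset.univ.filter fun e => sD e = kV y) hE.inj_f,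
    ← Finset.card_image_of_injective (Finset.univ.filter fun e => sK e = y)
      (hE.inj_m.comp hE.inj_l)]
  refine Eq.trans ?_ (Finset.card_union_add_card_inter _ _)
  congr 2
  · ext e
    simp only [Finset.mem_filter, Finset.mem_univ, true_and, Finset.mem_image, Finset.mem_union]
    constructor
    · intro he
      obtain ⟨e, rfl⟩ | ⟨e, rfl⟩ := hE.cover e
      · exact Or.inl ⟨e, hV.inj_m (by rw [hm, he]), rfl⟩
      · exact Or.inr ⟨e, hV.inj_f (by rw [hf, he, hV.comm]), rfl⟩
    · rintro (⟨e, he, rfl⟩ | ⟨e, he, rfl⟩)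
      · rw [← hm, he]
      · rw [← hf, he, hV.comm]
  · ext e
    simp only [Finset.mem_filter, Finset.mem_univ, true_and, Finset.mem_image, Finset.mem_inter,
      Function.comp]
    constructor
    · rintro ⟨e, rfl, rfl⟩
      exact ⟨⟨lE e, (hl e).symm, rfl⟩, ⟨kE e, (hk e).symm, (hE.comm e).symm⟩⟩
    · rintro ⟨⟨e, he, rfl⟩, ⟨d, hd, hde⟩⟩
      obtain ⟨c, rfl, rfl⟩ := hE.meet e d hde.symm
      exact ⟨c, hV.inj_l (by rw [hl, he]), rfl⟩

end Count

variable {l : K ⟶ L} {k : K ⟶ D} {m : L ⟶ G} {f : D ⟶ G}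

theorem IsSquare.deg_of_notMem (h : IsSquare l k m f) {x : L.V}
    (hx : x ∉ Set.range (nodeMap l)) : G.deg (nodeMap m x) = L.deg x := by
  unfold Graph.deg
  rw [h.node.card_incident_of_notMem h.edge (nodeMap_src m) (nodeMap_src f) hx,
    h.node.card_incident_of_notMem h.edge (nodeMap_tgt m) (nodeMap_tgt f) hx]

theorem IsSquare.deg_add (h : IsSquare l k m f) (y : K.V) :
    G.deg (nodeMap m (nodeMap l y)) + K.deg y = L.deg (nodeMap l y) + D.deg (nodeMap k y) := by
  have h₁ := h.node.card_incident h.edge (nodeMap_src l) (nodeMap_src k) (nodeMap_src m)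
    (nodeMap_src f) y
  have h₂ := h.node.card_incident h.edge (nodeMap_tgt l) (nodeMap_tgt k) (nodeMap_tgt m)
    (nodeMap_tgt f) y
  unfold Graph.deg
  omega

end Square

end GTS

/-! ## Encodings of graph transformation rules -/

namespace Encoding

open GTS CHR FirstOrder.Language

/-- Every later comparison of goals that decomposes a graph into disjoint kinds of items is reduced
by this to a bijection. -/
theorem map_univ_val_of_bijective {X Y Z C : Type*} [Fintype X] [Fintype Y] [Fintype Z]
    (q : X ⊕ Y → Z) (hq : Function.Bijective q) (f : Z → C) :
    (Finset.univ : Finset Z).val.map f =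
      (Finset.univ : Finset X).val.map (fun x => f (q (.inl x))) +
        (Finset.univ : Finset Y).val.map (fun y => f (q (.inr y))) := by
  classical
  have h : (Finset.univ : Finset Z) = Finset.univ.map (Equiv.ofBijective q hq).toEmbedding := by
    rw [Finset.map_univ_equiv]
  rw [h, Finset.map_val, Multiset.map_map, ← Finset.univ_disjSum_univ, Finset.val_disjSum,
    Multiset.disjSum, Multiset.map_add, Multiset.map_map, Multiset.map_map]
  rfl

/-! ### Terms and constraints under renaming, substitution and valuation -/

section Constraints

variable {TG : Graph.{a}} {Lx : FirstOrder.Language.{u, v}} {Var : Type w}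

theorem subst_cst (c : ℤ) (θ : Var → (Lang Lx).Term Var) :
    (cst c : (Lang Lx).Term Var).subst θ = cst c := by
  simp only [cst, Term.subst]
  congr 1
  funext i
  exact i.elim0

theorem relabel_cst (c : ℤ) (ρ : Var → Var) :
    (cst c : (Lang Lx).Term Var).relabel ρ = cst c := by
  simp only [cst, Term.relabel]
  congr 1
  funext i
  exact i.elim0

theorem relabel_plusT (s t : (Lang Lx).Term Var) (ρ : Var → Var) :
    (plusT s t).relabel ρ = plusT (s.relabel ρ) (t.relabel ρ) := by
  simp only [plusT, Term.relabel]
  congr 1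
  exact funext (Fin.forall_fin_two.2 ⟨rfl, rfl⟩)

theorem relabel_minusT (s t : (Lang Lx).Term Var) (ρ : Var → Var) :
    (minusT s t).relabel ρ = minusT (s.relabel ρ) (t.relabel ρ) := by
  simp only [minusT, Term.relabel]
  congr 1
  exact funext (Fin.forall_fin_two.2 ⟨rfl, rfl⟩)

theorem realize_plusT {M : Type*} [(Lang Lx).Structure M] {X Y : Type*} {η : X → M} {η' : Y → M}
    {s t : (Lang Lx).Term X} {s' t' : (Lang Lx).Term Y} (hs : s.realize η = s'.realize η')
    (ht : t.realize η = t'.realize η') :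
    (plusT s t).realize η = (plusT s' t').realize η' := by
  simp only [plusT, Term.realize]
  congr 1
  exact funext (Fin.forall_fin_two.2 ⟨hs, ht⟩)

theorem realize_minusT {M : Type*} [(Lang Lx).Structure M] {X Y : Type*} {η : X → M}
    {η' : Y → M} {s t : (Lang Lx).Term X} {s' t' : (Lang Lx).Term Y}
    (hs : s.realize η = s'.realize η') (ht : t.realize η = t'.realize η') :
    (minusT s t).realize η = (minusT s' t').realize η' := by
  simp only [minusT, Term.realize]
  congr 1
  exact funext (Fin.forall_fin_two.2 ⟨hs, ht⟩)

/-- The evaluation axioms are stated for valuations of `ℕ`; as constants are closed terms, they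
transfer to valuations of `Var`. -/
theorem realize_adjustment {CT : (Lang Lx).Theory} {F : Set (Σ n, (Lang Lx).Functions n)}
    (hCT : IsConstraintTheory CT F) (M : Model CT) (η : Var → M) (s : (Lang Lx).Term Var)
    (c c₁ c₂ : ℤ) (hs : s.realize η = (cst c : (Lang Lx).Term Var).realize η) :
    (plusT (minusT s (cst c₂)) (cst c₁)).realize η =
      (cst (c - c₂ + c₁) : (Lang Lx).Term Var).realize η := by
  have ρ : ℕ → M := fun _ => Classical.arbitrary M
  have h₁ : (minusT s (cst c₂)).realize η = (cst (c - c₂) : (Lang Lx).Term ℕ).realize ρ :=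
    (realize_minusT (hs.trans (realize_cst _ _ ρ)) (realize_cst _ _ ρ)).trans
      (hCT.eval_minus M c c₂ ρ)
  exact (realize_plusT h₁ (realize_cst _ _ ρ)).trans
    ((hCT.eval_plus M (c - c₂) c₁ ρ).trans (realize_cst _ _ _))

theorem nodeC_rename (τ : TG.V) (s d : (Lang Lx).Term Var) (ρ : Var → Var) :
    (nodeC τ s d).rename ρ = nodeC τ (s.relabel ρ) (d.relabel ρ) :=
  congrArg (User.mk (S := sig TG) (Sum.inl τ)) (funext (Fin.forall_fin_two.2 ⟨rfl, rfl⟩))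

theorem edgeC_rename (τ : TG.E) (e s t : (Lang Lx).Term Var) (ρ : Var → Var) :
    (edgeC τ e s t).rename ρ = edgeC τ (e.relabel ρ) (s.relabel ρ) (t.relabel ρ) :=
  congrArg (User.mk (S := sig TG) (Sum.inr τ))
    (funext (Fin.forall_fin_succ.2 ⟨rfl, Fin.forall_fin_two.2 ⟨rfl, rfl⟩⟩))

theorem nodeC_bind (τ : TG.V) (s d : (Lang Lx).Term Var) (θ : Var → (Lang Lx).Term Var) :
    (nodeC τ s d).bind θ = nodeC τ (s.subst θ) (d.subst θ) :=
  congrArg (User.mk (S := sig TG) (Sum.inl τ)) (funext (Fin.forall_fin_two.2 ⟨rfl, rfl⟩))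

theorem edgeC_bind (τ : TG.E) (e s t : (Lang Lx).Term Var) (θ : Var → (Lang Lx).Term Var) :
    (edgeC τ e s t).bind θ = edgeC τ (e.subst θ) (s.subst θ) (t.subst θ) :=
  congrArg (User.mk (S := sig TG) (Sum.inr τ))
    (funext (Fin.forall_fin_succ.2 ⟨rfl, Fin.forall_fin_two.2 ⟨rfl, rfl⟩⟩))

theorem chr_rename (G : TypedGraph.{a, b} TG) (var dvar : G.Item → Var) (E : Mode) (x : G.Item)
    (ρ : Var → Var) :
    (chr (Lx := Lx) G var dvar E x).rename ρ = chr G (ρ ∘ var) (ρ ∘ dvar) E x := by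
  rcases x with x | e
  · cases E
    · exact (nodeC_rename _ _ _ _).trans (by rw [relabel_cst]; rfl)
    · exact nodeC_rename _ _ _ _
  · cases E <;> exact edgeC_rename _ _ _ _ _

/-- Renaming of the variables of a variable assignment. -/
def VarMap.rename {X : Type b} (ν : VarMap X Var) (ρ : Equiv.Perm Var) : VarMap X Var where
  var := ρ ∘ ν.var
  dvar := ρ ∘ ν.dvar
  injective := by
    rw [← Sum.comp_elim]
    exact ρ.injective.comp ν.injective

/-- Renaming apart thus only changes the variable assignment, and the renamed rule is again an
encoding to which everything below applies. -/
theorem encode_rename (p : GTS.Rule.{a, b} TG) (ν : VarMap (RuleItem p) Var)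
    (ρ : Equiv.Perm Var) :
    (encode (Lx := Lx) p ν).rename ρ = encode p (ν.rename ρ) := by
  simp only [encode, CHR.Rule.rename, Multiset.map_add, Multiset.map_map, Function.comp_def,
    chr_rename, nodeC_rename, Multiset.map_bind, VarMap.rename, CHR.Rule.mk.injEq]
  refine ⟨trivial, rfl, ?_⟩
  congr 1
  funext x
  simp [Builtin.rename, relabel_plusT, relabel_minusT, relabel_cst, Term.relabel]

theorem nodeC_bind_eq_chr (H : TypedGraph.{a, b} TG) (μ δ : H.Item → Var)
    (θ : Var → (Lang Lx).Term Var) (h : H.V) {τ : TG.V} {x : Var} {d : (Lang Lx).Term Var}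
    (hτ : H.typ.onV h = τ) (hx : θ x = .var (μ (.inl h))) (hd : d.subst θ = cst (H.deg h)) :
    (nodeC τ (.var x) d).bind θ = chr H μ δ .gnd (.inl h) := by
  subst hτ
  rw [nodeC_bind, hd, Term.subst, hx]
  rfl

theorem edgeC_bind_eq_chr (H : TypedGraph.{a, b} TG) (μ δ : H.Item → Var)
    (θ : Var → (Lang Lx).Term Var) (h : H.E) {τ : TG.E} {x y z : Var}
    (hτ : H.typ.onE h = τ) (hx : θ x = .var (μ (.inr h)))
    (hy : θ y = .var (μ (.inl (H.src h)))) (hz : θ z = .var (μ (.inl (H.tgt h)))) :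
    (edgeC τ (.var x) (.var y) (.var z)).bind θ = chr H μ δ .gnd (.inr h) := by
  subst hτ
  rw [edgeC_bind, Term.subst, hx, Term.subst, hy, Term.subst, hz]
  rfl

theorem storeHolds_eqUser_nodeC {M : Type*} [(Lang Lx).Structure M] {η : Var → M} {τ τ' : TG.V}
    (h : τ = τ') (s d s' d' : (Lang Lx).Term Var) :
    storeHolds η (eqUser (nodeC τ s d) (nodeC τ' s' d')) ↔
      s.realize η = s'.realize η ∧ d.realize η = d'.realize η := by
  subst h
  exact (storeHolds_eqUser (S := sig TG) (Sum.inl τ) _ _).trans Fin.forall_fin_two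

theorem storeHolds_eqUser_edgeC {M : Type*} [(Lang Lx).Structure M] {η : Var → M} {τ τ' : TG.E}
    (h : τ = τ') (e s t e' s' t' : (Lang Lx).Term Var) :
    storeHolds η (eqUser (edgeC τ e s t) (edgeC τ' e' s' t')) ↔
      e.realize η = e'.realize η ∧ s.realize η = s'.realize η ∧ t.realize η = t'.realize η := by
  subst h
  exact (storeHolds_eqUser (S := sig TG) (Sum.inr τ) _ _).trans
    (Fin.forall_fin_succ.trans (and_congr_right fun _ => Fin.forall_fin_two))

end Constraints

/-! ### Heads of encoded rules -/

section Head

variable {TG : Graph.{a}} {Lx : FirstOrder.Language.{u, v}} {Var : Type w}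
  (p : GTS.Rule.{a, b} TG) (ν : VarMap (RuleItem p) Var)

open Classical in
/-- The constraint that encodes an item of the left-hand side of a rule. -/
noncomputable def headC (x : p.L.Item) : User (sig TG) Lx Var :=
  chr p.L (ν.var ∘ .inl) (ν.dvar ∘ .inl)
    (if x ∈ Set.range (itemMap p.l) then .kp else .gnd) x

open Classical in
/-- The degree argument of the constraint that encodes a node of the left-hand side. -/
noncomputable def degTerm (x : p.L.V) : (Lang Lx).Term Var :=
  if x ∈ Set.range (nodeMap p.l) then .var (ν.dvar (.inl (.inl x))) else cst (p.L.deg x)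

theorem inl_mem_range_itemMap {X Y : TypedGraph.{a, b} TG} (f : X ⟶ Y) (x : Y.V) :
    Sum.inl x ∈ Set.range (itemMap f) ↔ x ∈ Set.range (nodeMap f) := by
  simp [itemMap, Set.mem_range, Sum.exists]

theorem headC_inl (x : p.L.V) :
    headC (Lx := Lx) p ν (.inl x) =
      nodeC (p.L.typ.onV x) (.var (ν.var (.inl (.inl x)))) (degTerm p ν x) := by
  unfold headC degTerm
  by_cases hx : x ∈ Set.range (nodeMap p.l)
  · rw [if_pos ((inl_mem_range_itemMap p.l x).2 hx), if_pos hx]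
    rfl
  · rw [if_neg fun h => hx ((inl_mem_range_itemMap p.l x).1 h), if_neg hx]
    rfl

theorem headC_inr (e : p.L.E) :
    headC (Lx := Lx) p ν (.inr e) =
      edgeC (p.L.typ.onE e) (.var (ν.var (.inl (.inr e))))
        (.var (ν.var (.inl (.inl (p.L.src e))))) (.var (ν.var (.inl (.inl (p.L.tgt e))))) := by
  unfold headC
  split_ifs <;> rfl

theorem encode_head :
    (encode (Lx := Lx) p ν).head = (Finset.univ : Finset p.L.Item).val.map (headC p ν) := by
  classical
  let q : p.K.Item ⊕ {x : p.L.Item // x ∉ Set.range (itemMap p.l)} → p.L.Item :=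
    Sum.elim (itemMap p.l) Subtype.val
  have hq : Function.Bijective q := by
    constructor
    · refine p.inj_l.itemMap.sumElim Subtype.val_injective ?_
      rintro y ⟨x, hx⟩ rfl
      exact hx ⟨y, rfl⟩
    · intro x
      by_cases hx : x ∈ Set.range (itemMap p.l)
      · obtain ⟨y, rfl⟩ := hx
        exact ⟨.inl y, rfl⟩
      · exact ⟨.inr ⟨x, hx⟩, rfl⟩
  rw [map_univ_val_of_bijective q hq]
  refine congrArg₂ (· + ·) (Multiset.map_congr rfl fun y _ => ?_)
    (Multiset.map_congr rfl fun y _ => ?_)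
  · have : itemMap p.l y ∈ Set.range (itemMap p.l) := ⟨y, rfl⟩
    change _ = headC p ν (itemMap p.l y)
    rw [headC, if_pos this]
  · change _ = headC p ν y.1
    rw [headC, if_neg y.2]

variable {p ν} {G : TypedGraph.{a, b} TG} {m : p.L ⟶ G}

theorem subst_degTerm {θ : Var → (Lang Lx).Term Var}
    (hK : ∀ v, θ (ν.dvar (.inl (.inl (nodeMap p.l v)))) =
      cst (G.deg (nodeMap m (nodeMap p.l v))))
    (hdeg : ∀ x ∉ Set.range (nodeMap p.l), G.deg (nodeMap m x) = p.L.deg x) (x : p.L.V) :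
    (degTerm p ν x).subst θ = cst (G.deg (nodeMap m x)) := by
  unfold degTerm
  split_ifs with hx
  · obtain ⟨v, rfl⟩ := hx
    exact hK v
  · rw [subst_cst, hdeg x hx]

theorem realize_degTerm {M : Type*} [(Lang Lx).Structure M] {η : Var → M}
    (hK : ∀ v : p.K.V, η (ν.dvar (.inl (.inl (nodeMap p.l v)))) =
      (cst (G.deg (nodeMap m (nodeMap p.l v))) : (Lang Lx).Term Var).realize η)
    (hdeg : ∀ x ∉ Set.range (nodeMap p.l), G.deg (nodeMap m x) = p.L.deg x) (x : p.L.V) :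
    (degTerm p ν x : (Lang Lx).Term Var).realize η = (cst (G.deg (nodeMap m x)) : (Lang Lx).Term Var).realize η := by
  unfold degTerm
  split_ifs with hx
  · obtain ⟨v, rfl⟩ := hx
    exact hK v
  · rw [hdeg x hx]

end Head

/-! ## The overlap of two encoded rules along two matches -/

section Overlap

variable {TG : Graph.{a}} {Lx : FirstOrder.Language.{u, v}} {Var : Type w}
  {CT : (Lang Lx).Theory}
  {r₁ r₂ : GTS.Rule.{a, b} TG} {G : TypedGraph.{a, b} TG}

open Classical in
/-- The pairs of head constraints of items with the same image. -/
noncomputable def matchedPairs (ν₁ : VarMap (RuleItem r₁) Var) (ν₂ : VarMap (RuleItem r₂) Var)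
    (m₁ : r₁.L ⟶ G) (m₂ : r₂.L ⟶ G) :
    Multiset (User (sig TG) Lx Var × User (sig TG) Lx Var) :=
  (Finset.univ : Finset {q : r₁.L.Item × r₂.L.Item //
    itemMap m₁ q.1 = itemMap m₂ q.2}).val.map fun q => (headC r₁ ν₁ q.1.1, headC r₂ ν₂ q.1.2)

open Classical in
/-- The head constraints of the items outside the image of the other match. -/
noncomputable def unmatched (ν₁ : VarMap (RuleItem r₁) Var) (m₁ : r₁.L ⟶ G) (m₂ : r₂.L ⟶ G) :
    Goal (sig TG) Lx Var :=
  (Finset.univ : Finset {x : r₁.L.Item // itemMap m₁ x ∉ Set.range (itemMap m₂)}).val.map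
    fun x => headC r₁ ν₁ x.1

/-- Injectivity of `m₂` leaves each item of the first left-hand side at most one partner, so
projecting the matched pairs repeats no item. -/
theorem encode_head_eq_left (ν₁ : VarMap (RuleItem r₁) Var) (ν₂ : VarMap (RuleItem r₂) Var)
    (m₁ : r₁.L ⟶ G) (m₂ : r₂.L ⟶ G) (h₂ : Inj m₂) :
    (encode (Lx := Lx) r₁ ν₁).head =
      unmatched ν₁ m₁ m₂ + (matchedPairs ν₁ ν₂ m₁ m₂).map Prod.fst := by
  classical
  rw [encode_head, map_univ_val_of_bijective
    (X := {x : r₁.L.Item // itemMap m₁ x ∉ Set.range (itemMap m₂)})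
    (Y := {q : r₁.L.Item × r₂.L.Item // itemMap m₁ q.1 = itemMap m₂ q.2})
    (Sum.elim Subtype.val fun q => q.1.1), unmatched, matchedPairs, Multiset.map_map]
  · rfl
  · constructor
    · refine Subtype.val_injective.sumElim ?_ ?_
      · rintro ⟨⟨x, y⟩, h⟩ ⟨⟨x', y'⟩, h'⟩ (rfl : x = x')
        have : y = y' := h₂.itemMap (h.symm.trans h')
        subst this
        rfl
      · rintro ⟨x, hx⟩ ⟨⟨x', y⟩, h⟩ (rfl : x = x')
        exact hx ⟨y, h.symm⟩
    · intro x
      by_cases hx : itemMap m₁ x ∈ Set.range (itemMap m₂)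
      · obtain ⟨y, hy⟩ := hx
        exact ⟨.inr ⟨(x, y), hy.symm⟩, rfl⟩
      · exact ⟨.inl ⟨x, hx⟩, rfl⟩

theorem map_swap_matchedPairs (ν₁ : VarMap (RuleItem r₁) Var) (ν₂ : VarMap (RuleItem r₂) Var)
    (m₁ : r₁.L ⟶ G) (m₂ : r₂.L ⟶ G) :
    (matchedPairs (Lx := Lx) ν₁ ν₂ m₁ m₂).map Prod.swap = matchedPairs ν₂ ν₁ m₂ m₁ := by
  classical
  let e : {q : r₁.L.Item × r₂.L.Item // itemMap m₁ q.1 = itemMap m₂ q.2} ≃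
      {q : r₂.L.Item × r₁.L.Item // itemMap m₂ q.1 = itemMap m₁ q.2} :=
    (Equiv.prodComm _ _).subtypeEquiv fun _ => eq_comm
  rw [matchedPairs, matchedPairs, ← Finset.map_univ_equiv e, Finset.map_val, Multiset.map_map,
    Multiset.map_map]
  rfl

theorem encode_head_eq_right (ν₁ : VarMap (RuleItem r₁) Var) (ν₂ : VarMap (RuleItem r₂) Var)
    (m₁ : r₁.L ⟶ G) (m₂ : r₂.L ⟶ G) (h₁ : Inj m₁) :
    (encode (Lx := Lx) r₂ ν₂).head =
      unmatched ν₂ m₂ m₁ + (matchedPairs ν₁ ν₂ m₁ m₂).map Prod.snd := by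
  rw [encode_head_eq_left ν₂ ν₁ m₂ m₁ h₁, ← map_swap_matchedPairs ν₁ ν₂, Multiset.map_map]
  rfl

/-- The equations between the matched head constraints. -/
noncomputable def matchedEqs (ν₁ : VarMap (RuleItem r₁) Var) (ν₂ : VarMap (RuleItem r₂) Var)
    (m₁ : r₁.L ⟶ G) (m₂ : r₂.L ⟶ G) : Store Lx Var :=
  (matchedPairs ν₁ ν₂ m₁ m₂).bind fun q => eqUser q.1 q.2

theorem storeHolds_matchedEqs {ν₁ : VarMap (RuleItem r₁) Var} {ν₂ : VarMap (RuleItem r₂) Var}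
    {m₁ : r₁.L ⟶ G} {m₂ : r₂.L ⟶ G} {M : Type*} [(Lang Lx).Structure M] {η : Var → M} :
    storeHolds η (matchedEqs (Lx := Lx) ν₁ ν₂ m₁ m₂) ↔
      ∀ x y, itemMap m₁ x = itemMap m₂ y →
        storeHolds η (eqUser (headC (Lx := Lx) r₁ ν₁ x) (headC r₂ ν₂ y)) := by
  rw [matchedEqs, matchedPairs, Multiset.bind_map, storeHolds_bind]
  simp

theorem matchedEqs_comm (ν₁ : VarMap (RuleItem r₁) Var) (ν₂ : VarMap (RuleItem r₂) Var)
    (m₁ : r₁.L ⟶ G) (m₂ : r₂.L ⟶ G) :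
    StoreEquiv CT (matchedEqs ν₁ ν₂ m₁ m₂) (matchedEqs ν₂ ν₁ m₂ m₁) := by
  intro M η
  rw [storeHolds_matchedEqs, storeHolds_matchedEqs, forall_comm]
  refine forall_congr' fun x => forall_congr' fun y => ?_
  rw [eq_comm, storeHolds_eqUser_comm]

theorem typ_eq_of_node {m₁ : r₁.L ⟶ G} {m₂ : r₂.L ⟶ G} {x : r₁.L.V} {y : r₂.L.V}
    (h : nodeMap m₁ x = nodeMap m₂ y) : r₁.L.typ.onV x = r₂.L.typ.onV y := by
  rw [← typ_nodeMap m₁, h, typ_nodeMap]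

theorem typ_eq_of_edge {m₁ : r₁.L ⟶ G} {m₂ : r₂.L ⟶ G} {x : r₁.L.E} {y : r₂.L.E}
    (h : edgeMap m₁ x = edgeMap m₂ y) : r₁.L.typ.onE x = r₂.L.typ.onE y := by
  rw [← typ_edgeMap m₁, h, typ_edgeMap]

/-- The constraints that fix the degree variables of the preserved nodes to their degree in the
host graph. -/
noncomputable def degStore {p : GTS.Rule.{a, b} TG} (ν : VarMap (RuleItem p) Var)
    (m : p.L ⟶ G) : Store Lx Var :=
  (Finset.univ : Finset p.K.V).val.map fun x =>
    Builtin.eq (.var (ν.dvar (.inl (.inl (nodeMap p.l x)))))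
      (cst (G.deg (nodeMap m (nodeMap p.l x))))

theorem storeHolds_degStore {p : GTS.Rule.{a, b} TG} {ν : VarMap (RuleItem p) Var}
    {m : p.L ⟶ G} {M : Type*} [(Lang Lx).Structure M] {η : Var → M} :
    storeHolds η (degStore (Lx := Lx) ν m) ↔
      ∀ x, η (ν.dvar (.inl (.inl (nodeMap p.l x)))) =
        (cst (G.deg (nodeMap m (nodeMap p.l x))) : (Lang Lx).Term Var).realize η := by
  simp [storeHolds, degStore, Builtin.Holds]

theorem isConstEq_of_mem_degStore {p : GTS.Rule.{a, b} TG} {ν : VarMap (RuleItem p) Var}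
    {m : p.L ⟶ G} {β : Builtin Lx Var} (h : β ∈ degStore ν m) : IsConstEq β := by
  obtain ⟨x, -, rfl⟩ := Multiset.mem_map.1 h
  exact ⟨_, _, rfl⟩

/-- Fixed degree variables make the degree equations automatic, as both sides denote the degree of
the common image. The source and target equations of a matched pair of edges are identifier
equations of matched nodes, because matches commute with source and target. -/
theorem storeHolds_matchedEqs_iff {ν₁ : VarMap (RuleItem r₁) Var}
    {ν₂ : VarMap (RuleItem r₂) Var} {m₁ : r₁.L ⟶ G} {m₂ : r₂.L ⟶ G}
    (hdeg₁ : ∀ x ∉ Set.range (nodeMap r₁.l), G.deg (nodeMap m₁ x) = r₁.L.deg x)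
    (hdeg₂ : ∀ x ∉ Set.range (nodeMap r₂.l), G.deg (nodeMap m₂ x) = r₂.L.deg x)
    {M : Type*} [(Lang Lx).Structure M] {η : Var → M}
    (h₁ : storeHolds η (degStore (Lx := Lx) ν₁ m₁))
    (h₂ : storeHolds η (degStore (Lx := Lx) ν₂ m₂)) :
    storeHolds η (matchedEqs (Lx := Lx) ν₁ ν₂ m₁ m₂) ↔
      ∀ x y, itemMap m₁ x = itemMap m₂ y → η (ν₁.var (.inl x)) = η (ν₂.var (.inl y)) := by
  rw [storeHolds_matchedEqs]
  rw [storeHolds_degStore] at h₁ h₂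
  constructor
  · rintro h (x | x) (y | y) hxy
    · have := h _ _ hxy
      rw [headC_inl, headC_inl,
        storeHolds_eqUser_nodeC (typ_eq_of_node (Sum.inl_injective hxy))] at this
      exact this.1
    · simp [itemMap] at hxy
    · simp [itemMap] at hxy
    · have := h _ _ hxy
      rw [headC_inr, headC_inr,
        storeHolds_eqUser_edgeC (typ_eq_of_edge (Sum.inr_injective hxy))] at this
      exact this.1
  · rintro h (x | x) (y | y) hxy
    · have hxy' := Sum.inl_injective hxy
      rw [headC_inl, headC_inl, storeHolds_eqUser_nodeC (typ_eq_of_node hxy')]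
      exact ⟨h _ _ hxy, by rw [realize_degTerm h₁ hdeg₁, realize_degTerm h₂ hdeg₂, hxy']⟩
    · simp [itemMap] at hxy
    · simp [itemMap] at hxy
    · have hxy' := Sum.inr_injective hxy
      rw [headC_inr, headC_inr, storeHolds_eqUser_edgeC (typ_eq_of_edge hxy')]
      refine ⟨h _ _ hxy, h _ _ (congrArg Sum.inl ?_), h _ _ (congrArg Sum.inl ?_)⟩
      · rw [nodeMap_src, nodeMap_src, hxy']
      · rw [nodeMap_tgt, nodeMap_tgt, hxy']

/-- The store is equivalent to a conjunction of constraints `X = c` and `X = Y + c₁ - c₂`. -/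
def HasDegreeForm (CT : (Lang Lx).Theory) (𝔹 : Store Lx Var) : Prop :=
  ∃ 𝔹' : Store Lx Var, (∀ β ∈ 𝔹', IsConstEq β ∨ IsAdjustment β) ∧ StoreEquiv CT 𝔹 𝔹'

theorem HasDegreeForm.of_forall {𝔹 : Store Lx Var} (h : ∀ β ∈ 𝔹, IsConstEq β ∨ IsAdjustment β) :
    HasDegreeForm CT 𝔹 :=
  ⟨𝔹, h, fun _ _ => Iff.rfl⟩

theorem HasDegreeForm.congr {𝔹 𝔹' : Store Lx Var} (h : HasDegreeForm CT 𝔹)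
    (e : StoreEquiv CT 𝔹' 𝔹) : HasDegreeForm CT 𝔹' := by
  obtain ⟨𝔹₁, h₁, e₁⟩ := h
  exact ⟨𝔹₁, h₁, fun M η => (e M η).trans (e₁ M η)⟩

theorem HasDegreeForm.add {𝔹 𝔹' : Store Lx Var} (h : HasDegreeForm CT 𝔹)
    (h' : HasDegreeForm CT 𝔹') : HasDegreeForm CT (𝔹 + 𝔹') := by
  obtain ⟨𝔹₁, h₁, e₁⟩ := h
  obtain ⟨𝔹₂, h₂, e₂⟩ := h'
  refine ⟨𝔹₁ + 𝔹₂, fun β hβ => (Multiset.mem_add.1 hβ).elim (h₁ β) (h₂ β), fun M η => ?_⟩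
  rw [storeHolds_add, storeHolds_add, e₁ M η, e₂ M η]

theorem HasDegreeForm.bind {ι : Type*} {s : Multiset ι} {f : ι → Store Lx Var}
    (h : ∀ i ∈ s, HasDegreeForm CT (f i)) : HasDegreeForm CT (s.bind f) := by
  induction s using Multiset.induction_on with
  | empty => exact .of_forall (by simp)
  | cons i s ih =>
    rw [Multiset.cons_bind]
    exact (h i (by simp)).add (ih fun j hj => h j (Multiset.mem_cons_of_mem hj))

theorem hasDegreeForm_eq_var_var (x y : Var) :
    HasDegreeForm CT {Builtin.eq (Lx := Lx) (.var x) (.var y)} :=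
  .of_forall fun _ hβ => Or.inr ⟨x, y, Or.inl (Multiset.mem_singleton.1 hβ)⟩

theorem hasDegreeForm_eq_var_cst (x : Var) (c : ℤ) :
    HasDegreeForm CT {Builtin.eq (Lx := Lx) (.var x) (cst c)} :=
  .of_forall fun _ hβ => Or.inl ⟨x, c, Multiset.mem_singleton.1 hβ⟩

theorem storeHolds_singleton {M : Type*} [(Lang Lx).Structure M] {η : Var → M}
    {β : Builtin Lx Var} : storeHolds η {β} ↔ β.Holds η := by
  simp [storeHolds]

/-- The matched equations may contain `c = X` and `c = c'`, which are not of the admissible shape.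
The former are reversed, the latter shown to be true and dropped. -/
theorem hasDegreeForm_matchedEqs {ν₁ : VarMap (RuleItem r₁) Var}
    {ν₂ : VarMap (RuleItem r₂) Var} {m₁ : r₁.L ⟶ G} {m₂ : r₂.L ⟶ G}
    (hdeg₁ : ∀ x ∉ Set.range (nodeMap r₁.l), G.deg (nodeMap m₁ x) = r₁.L.deg x)
    (hdeg₂ : ∀ x ∉ Set.range (nodeMap r₂.l), G.deg (nodeMap m₂ x) = r₂.L.deg x) :
    HasDegreeForm CT (matchedEqs ν₁ ν₂ m₁ m₂) := by
  refine .bind fun q hq => ?_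
  obtain ⟨⟨⟨x | x, y | y⟩, hxy⟩, -, rfl⟩ := Multiset.mem_map.1 hq
  · have hxy' : nodeMap m₁ x = nodeMap m₂ y := Sum.inl_injective hxy
    have key : HasDegreeForm CT {Builtin.eq (degTerm r₁ ν₁ x) (degTerm r₂ ν₂ y)} := by
      unfold degTerm
      split_ifs with hx hy hy
      · exact hasDegreeForm_eq_var_var _ _
      · exact hasDegreeForm_eq_var_cst _ _
      · refine (hasDegreeForm_eq_var_cst (ν₂.dvar (.inl (.inl y))) (r₁.L.deg x)).congr ?_
        exact fun M η => by simp only [storeHolds_singleton, Builtin.Holds, eq_comm]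
      -- Both nodes are deleted; each constant is the degree of the common image in `G`, so the
      -- equation is trivial.
      · refine (HasDegreeForm.of_forall (𝔹 := 0) (by simp)).congr fun M η => ?_
        rw [← hdeg₁ x hx, ← hdeg₂ y hy, hxy', storeHolds_singleton]
        simp [Builtin.Holds, storeHolds]
    refine ((hasDegreeForm_eq_var_var (ν₁.var (.inl (.inl x))) (ν₂.var (.inl (.inl y)))).add
      key).congr fun M η => ?_
    dsimp only
    rw [headC_inl, headC_inl, storeHolds_eqUser_nodeC (typ_eq_of_node hxy'), storeHolds_add,
      storeHolds_singleton, storeHolds_singleton]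
    rfl
  · simp [itemMap] at hxy
  · simp [itemMap] at hxy
  · have hxy' : edgeMap m₁ x = edgeMap m₂ y := Sum.inr_injective hxy
    refine ((hasDegreeForm_eq_var_var (ν₁.var (.inl (.inr x))) (ν₂.var (.inl (.inr y)))).add
      ((hasDegreeForm_eq_var_var (ν₁.var (.inl (.inl (r₁.L.src x))))
        (ν₂.var (.inl (.inl (r₂.L.src y))))).add
      (hasDegreeForm_eq_var_var (ν₁.var (.inl (.inl (r₁.L.tgt x))))
        (ν₂.var (.inl (.inl (r₂.L.tgt y))))))).congr fun M η => ?_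
    dsimp only
    rw [headC_inr, headC_inr, storeHolds_eqUser_edgeC (typ_eq_of_edge hxy'), storeHolds_add,
      storeHolds_add, storeHolds_singleton, storeHolds_singleton, storeHolds_singleton]
    rfl

/-- The grounding can be computed with the original store: replacing it by its admissible form
preserves the solutions also after `B` is added. -/
theorem isGStateBasedOn_of_storeEquiv {𝔾 : Goal (sig TG) Lx Var} {𝔹 : Store Lx Var}
    {𝕍 : Set Var} {H : TypedGraph.{a, b} TG} (hform : HasDegreeForm CT 𝔹) (B : Store Lx Var)
    (hB : ∀ β ∈ B, IsConstEq β) (ν : VarMap H.Item Var)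
    (h : StateEquiv CT ⟨𝔾, 𝔹 + B, ∅⟩ ⟨chrGraph .gnd H ν, 0, ∅⟩) :
    IsGStateBasedOn CT ⟨𝔾, 𝔹, 𝕍⟩ H := by
  obtain ⟨𝔹', h', e⟩ := hform
  refine ⟨𝔾, 𝔹', 𝕍, e.stateEquiv _ _, h', B, ν, hB, ?_⟩
  refine Relation.EqvGen.trans _ _ _ (StoreEquiv.stateEquiv ?_ _ _) h
  intro M η
  rw [storeHolds_add, storeHolds_add, e M η]

/-- Two variable assignments without common variables. -/
def VarMap.Apart {X Y : Type b} (ν₁ : VarMap X Var) (ν₂ : VarMap Y Var) : Prop :=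
  ∀ i j, Sum.elim ν₁.var ν₁.dvar i ≠ Sum.elim ν₂.var ν₂.dvar j

theorem VarMap.Apart.symm {X Y : Type b} {ν₁ : VarMap X Var} {ν₂ : VarMap Y Var}
    (h : ν₁.Apart ν₂) : ν₂.Apart ν₁ :=
  fun i j => (h j i).symm

theorem VarMap.Apart.injective {X Y : Type b} {ν₁ : VarMap X Var} {ν₂ : VarMap Y Var}
    (h : ν₁.Apart ν₂) :
    Function.Injective
      (Sum.elim (Sum.elim ν₁.var ν₁.dvar) (Sum.elim ν₂.var ν₂.dvar)) :=
  ν₁.injective.sumElim ν₂.injective h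

end Overlap

/-! ### The overlap state and the critical pair as states based on graphs -/

section States

variable {TG : Graph.{a}} {Lx : FirstOrder.Language.{u, v}} {Var : Type w}
  {CT : (Lang Lx).Theory}
  {r₁ r₂ : GTS.Rule.{a, b} TG} {G P : TypedGraph.{a, b} TG}
  {ν₁ : VarMap (RuleItem r₁) Var} {ν₂ : VarMap (RuleItem r₂) Var}
  {m₁ : r₁.L ⟶ G} {m₂ : r₂.L ⟶ G}

theorem headC_bind_eq_chr {p : GTS.Rule.{a, b} TG} {ν : VarMap (RuleItem p) Var} {m : p.L ⟶ G}
    {θ : Var → (Lang Lx).Term Var} {μ δ : G.Item → Var}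
    (hid : ∀ x, θ (ν.var (.inl x)) = .var (μ (itemMap m x)))
    (hK : ∀ v : p.K.V, θ (ν.dvar (.inl (.inl (nodeMap p.l v)))) =
      cst (G.deg (nodeMap m (nodeMap p.l v))))
    (hdeg : ∀ x ∉ Set.range (nodeMap p.l), G.deg (nodeMap m x) = p.L.deg x) (x : p.L.Item) :
    (headC p ν x).bind θ = chr G μ δ .gnd (itemMap m x) := by
  rcases x with x | e
  · rw [headC_inl]
    exact nodeC_bind_eq_chr G μ δ θ _ (typ_nodeMap m x) (hid _) (subst_degTerm hK hdeg x)
  · rw [headC_inr]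
    refine edgeC_bind_eq_chr G μ δ θ _ (typ_edgeMap m e) (hid _) ?_ ?_
    · rw [hid, ← nodeMap_src]
      rfl
    · rw [hid, ← nodeMap_tgt]
      rfl

/-- These variables form a subfamily of the injective family of all variables of both assignments;
`j` embeds the index sets. -/
theorem injective_overlapVars (hν : ν₁.Apart ν₂) :
    Function.Injective (Sum.elim
      (Sum.elim (fun x : r₁.L.Item => ν₁.var (.inl x)) fun x : r₂.L.Item => ν₂.var (.inl x))
      (Sum.elim (fun v => ν₁.dvar (.inl (.inl (nodeMap r₁.l v))))
        fun v => ν₂.dvar (.inl (.inl (nodeMap r₂.l v))))) := by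
  let j : (r₁.L.Item ⊕ r₂.L.Item) ⊕ (r₁.K.V ⊕ r₂.K.V) →
      (RuleItem r₁ ⊕ RuleItem r₁) ⊕ (RuleItem r₂ ⊕ RuleItem r₂) :=
    Sum.elim (Sum.elim (fun x => .inl (.inl (.inl x))) fun x => .inr (.inl (.inl x)))
      (Sum.elim (fun v => .inl (.inr (.inl (.inl (nodeMap r₁.l v)))))
        fun v => .inr (.inr (.inl (.inl (nodeMap r₂.l v)))))
  have hj : Function.Injective j := by
    rintro ((x | x) | (x | x)) ((y | y) | (y | y)) h <;>
      simp_all [j, r₁.inj_l.1.eq_iff, r₂.inj_l.1.eq_iff]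
  convert hν.injective.comp hj using 1
  funext x
  rcases x with (x | x) | (x | x) <;> rfl

theorem injective_resultVars (hν : ν₁.Apart ν₂) :
    Function.Injective (Sum.elim
      (Sum.elim ν₁.var fun x : r₂.L.Item => ν₂.var (.inl x))
      (Sum.elim (Sum.elim (fun v => ν₁.dvar (.inl (.inl (nodeMap r₁.l v))))
          fun v => ν₁.dvar (.inr (.inr v)))
        fun v => ν₂.dvar (.inl (.inl (nodeMap r₂.l v))))) := by
  let j : (RuleItem r₁ ⊕ r₂.L.Item) ⊕ ((r₁.K.V ⊕ r₁.K.V) ⊕ r₂.K.V) →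
      (RuleItem r₁ ⊕ RuleItem r₁) ⊕ (RuleItem r₂ ⊕ RuleItem r₂) :=
    Sum.elim (Sum.elim (fun x => .inl (.inl x)) fun x => .inr (.inl (.inl x)))
      (Sum.elim (Sum.elim (fun v => .inl (.inr (.inl (.inl (nodeMap r₁.l v)))))
        fun v => .inl (.inr (.inr (.inr v))))
        fun v => .inr (.inr (.inl (.inl (nodeMap r₂.l v)))))
  have hj : Function.Injective j := by
    rintro ((x | x) | ((x | x) | x)) ((y | y) | ((y | y) | y)) h <;>
      simp_all [j, r₁.inj_l.1.eq_iff, r₂.inj_l.1.eq_iff]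
  convert hν.injective.comp hj using 1
  funext x
  rcases x with (x | x) | ((x | x) | x) <;> rfl

/-- The class of an identifier is the image of its item in `G`. Within one left-hand side a class
has a single member since the match is injective, so equations across the two sides generate
everything. -/
theorem isGStateBasedOn_overlap [Infinite Var] (h₁ : Inj m₁) (h₂ : Inj m₂)
    (hdeg₁ : ∀ x ∉ Set.range (nodeMap r₁.l), G.deg (nodeMap m₁ x) = r₁.L.deg x)
    (hdeg₂ : ∀ x ∉ Set.range (nodeMap r₂.l), G.deg (nodeMap m₂ x) = r₂.L.deg x)
    (hcover : Set.range (itemMap m₁) ∪ Set.range (itemMap m₂) = Set.univ)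
    (hν : ν₁.Apart ν₂) (𝕍 : Set Var) :
    IsGStateBasedOn CT ⟨(encode r₁ ν₁).head + unmatched ν₂ m₂ m₁, matchedEqs ν₁ ν₂ m₁ m₂, 𝕍⟩
      G := by
  classical
  obtain ⟨ν, θ, hνinj, hid, hd, hequiv⟩ := stateEquiv_of_classes (CT := CT)
    ((encode r₁ ν₁).head + unmatched ν₂ m₂ m₁)
    (matchedEqs ν₁ ν₂ m₁ m₂ + (degStore ν₁ m₁ + degStore ν₂ m₂))
    (J := r₁.L.Item ⊕ r₂.L.Item) (D := r₁.K.V ⊕ r₂.K.V) (T := G.Item ⊕ G.Item)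
    (Sum.elim (fun x => ν₁.var (.inl x)) fun x => ν₂.var (.inl x))
    (Sum.elim (fun v => ν₁.dvar (.inl (.inl (nodeMap r₁.l v))))
      fun v => ν₂.dvar (.inl (.inl (nodeMap r₂.l v))))
    (injective_overlapVars hν)
    (Sum.elim (fun x => .inl (itemMap m₁ x)) fun x => .inl (itemMap m₂ x))
    (Sum.elim (fun v => G.deg (nodeMap m₁ (nodeMap r₁.l v)))
      fun v => G.deg (nodeMap m₂ (nodeMap r₂.l v)))
    (by
      intro M η
      rw [storeHolds_add, storeHolds_add]
      constructor
      · rintro ⟨he, hd₁, hd₂⟩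
        rw [storeHolds_matchedEqs_iff hdeg₁ hdeg₂ hd₁ hd₂] at he
        rw [storeHolds_degStore] at hd₁ hd₂
        refine ⟨?_, ?_⟩
        · rintro (x | x) (y | y) hxy
          · rw [h₁.itemMap (Sum.inl_injective hxy)]
          · exact he _ _ (Sum.inl_injective hxy)
          · exact (he _ _ (Sum.inl_injective hxy).symm).symm
          · rw [h₂.itemMap (Sum.inl_injective hxy)]
        · rintro (v | v)
          · exact hd₁ v
          · exact hd₂ v
      · rintro ⟨hid, hd⟩
        have hd₁ := storeHolds_degStore.2 fun v => hd (.inl v)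
        have hd₂ := storeHolds_degStore.2 fun v => hd (.inr v)
        refine ⟨?_, hd₁, hd₂⟩
        rw [storeHolds_matchedEqs_iff hdeg₁ hdeg₂ hd₁ hd₂]
        exact fun x y hxy => hid (.inl x) (.inr y) (congrArg Sum.inl hxy))
  -- The second copy of `G.Item` among the classes only supplies the degree variables of a `VarMap`;
  -- they do not occur in the ground encoding.
  let ν' : VarMap G.Item Var := ⟨ν ∘ .inl, ν ∘ .inr, by simpa using hνinj⟩
  refine isGStateBasedOn_of_storeEquiv (hasDegreeForm_matchedEqs hdeg₁ hdeg₂)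
    (degStore ν₁ m₁ + degStore ν₂ m₂) (fun β hβ => (Multiset.mem_add.1 hβ).elim
      isConstEq_of_mem_degStore isConstEq_of_mem_degStore) ν' ?_
  convert hequiv using 2
  let q : r₁.L.Item ⊕ {x : r₂.L.Item // itemMap m₂ x ∉ Set.range (itemMap m₁)} → G.Item :=
    Sum.elim (itemMap m₁) fun x => itemMap m₂ x.1
  have hq : Function.Bijective q := by
    constructor
    · refine h₁.itemMap.sumElim (h₂.itemMap.comp Subtype.val_injective) ?_
      exact fun x y hxy => y.2 ⟨x, hxy⟩
    · intro g
      by_cases hg : g ∈ Set.range (itemMap m₁)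
      · obtain ⟨x, rfl⟩ := hg
        exact ⟨.inl x, rfl⟩
      · obtain ⟨y, rfl⟩ := ((Set.ext_iff.1 hcover g).2 trivial).resolve_left hg
        exact ⟨.inr ⟨y, hg⟩, rfl⟩
  rw [chrGraph, map_univ_val_of_bijective q hq, Multiset.map_add, encode_head, unmatched,
    Multiset.map_map, Multiset.map_map]
  congr 1
  · refine Multiset.map_congr rfl fun x _ => ?_
    exact (headC_bind_eq_chr (fun x => hid (.inl x)) (fun v => hd (.inl v)) hdeg₁ x).symm
  · refine Multiset.map_congr rfl fun x _ => ?_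
    exact (headC_bind_eq_chr (fun x => hid (.inr x)) (fun v => hd (.inr v)) hdeg₂ x.1).symm

/-- All identifiers may take one and the same value `z`, so only the degree variables need care:
they receive the degrees in `G`. -/
theorem satisfiable_matchedEqs
    (hdeg₁ : ∀ x ∉ Set.range (nodeMap r₁.l), G.deg (nodeMap m₁ x) = r₁.L.deg x)
    (hdeg₂ : ∀ x ∉ Set.range (nodeMap r₂.l), G.deg (nodeMap m₂ x) = r₂.L.deg x)
    (hν : ν₁.Apart ν₂) : Satisfiable CT (matchedEqs ν₁ ν₂ m₁ m₂) := by
  intro M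
  obtain ⟨z⟩ : Nonempty M := inferInstance
  let c : ℤ → M := fun n => (cst n : (Lang Lx).Term Var).realize fun _ => z
  let f : RuleItem r₁ → M :=
    Sum.elim (Sum.elim (fun x => c (G.deg (nodeMap m₁ x))) fun _ => z) fun _ => z
  let g : RuleItem r₂ → M :=
    Sum.elim (Sum.elim (fun x => c (G.deg (nodeMap m₂ x))) fun _ => z) fun _ => z
  let η : Var → M := Function.extend
    (Sum.elim (Sum.elim ν₁.var ν₁.dvar) (Sum.elim ν₂.var ν₂.dvar))
    (Sum.elim (Sum.elim (fun _ => z) f) (Sum.elim (fun _ => z) g)) fun _ => z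
  have hη := fun i => hν.injective.extend_apply
    (Sum.elim (Sum.elim (fun _ => z) f) (Sum.elim (fun _ => z) g)) (fun _ => z) i
  refine ⟨η, (storeHolds_matchedEqs_iff hdeg₁ hdeg₂ (storeHolds_degStore.2 fun v => ?_)
    (storeHolds_degStore.2 fun v => ?_)).2 fun x y _ => ?_⟩
  · exact (hη (.inl (.inr (.inl (.inl (nodeMap r₁.l v)))))).trans (realize_cst _ _ _)
  · exact (hη (.inr (.inr (.inl (.inl (nodeMap r₂.l v)))))).trans (realize_cst _ _ _)
  · exact (hη (.inl (.inl (.inl x)))).trans (hη (.inr (.inl (.inl y)))).symm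

theorem hasDegreeForm_bodyB (p : GTS.Rule.{a, b} TG) (ν : VarMap (RuleItem p) Var) :
    HasDegreeForm CT (encode p ν).bodyB := by
  refine .of_forall fun β hβ => Or.inr ?_
  obtain ⟨x, -, hx⟩ := Multiset.mem_bind.1 hβ
  obtain rfl | hx := Multiset.mem_cons.1 hx
  · exact ⟨_, _, Or.inl rfl⟩
  · exact ⟨_, _, Or.inr ⟨_, _, Or.inr (Multiset.mem_singleton.1 hx)⟩⟩

theorem storeHolds_bodyB {p : GTS.Rule.{a, b} TG} {ν : VarMap (RuleItem p) Var} {M : Type*}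
    [(Lang Lx).Structure M] {η : Var → M} :
    storeHolds η (encode (Lx := Lx) p ν).bodyB ↔ ∀ v : p.K.V,
      η (ν.var (.inl (.inl (nodeMap p.l v)))) = η (ν.var (.inr (.inr v))) ∧
        η (ν.dvar (.inr (.inr v))) =
          (plusT (minusT (.var (ν.dvar (.inl (.inl (nodeMap p.l v)))))
            (cst (p.L.deg (nodeMap p.l v)))) (cst (p.R.deg (nodeMap p.r v))) :
              (Lang Lx).Term Var).realize η := by
  simp only [encode, storeHolds_bind]
  simp [storeHolds, Builtin.Holds]

/-- An item of the result of a transformation is either preserved, and then comes from an item of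
the host graph, or created. -/
theorem exists_origin {K L R D H P : Type*} {l : K → L} {k : K → D} {m : L → H} {f : D → H}
    {r : K → R} {n : R → P} {g : D → P} (h : IsBicartesian l k m f) (h' : IsBicartesian r k n g) :
    ∃ o : P → H ⊕ {x : R // x ∉ Set.range r}, Function.Injective o ∧
      (∀ d, o (g d) = .inl (f d)) ∧ (∀ y, o (n (r y)) = .inl (m (l y))) ∧
        ∀ x, o (n x.1) = .inr x := by
  have key : ∀ p, ∃ t : H ⊕ {x : R // x ∉ Set.range r}, (∀ d, g d = p → t = .inl (f d)) ∧
      ∀ x : {x : R // x ∉ Set.range r}, n x.1 = p → t = .inr x := by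
    intro p
    by_cases hp : ∃ d, g d = p
    · obtain ⟨d, rfl⟩ := hp
      refine ⟨.inl (f d), fun d' hd' => by rw [h'.inj_f hd'], fun x hx => ?_⟩
      obtain ⟨y, hy, -⟩ := h'.meet _ _ hx
      exact absurd ⟨y, hy⟩ x.2
    · obtain ⟨x, rfl⟩ := (h'.cover p).resolve_right hp
      have hx : x ∉ Set.range r := by
        rintro ⟨y, rfl⟩
        exact hp ⟨k y, (h'.comm y).symm⟩
      exact ⟨.inr ⟨x, hx⟩, fun d hd => absurd ⟨d, hd⟩ hp,
        fun x' hx' => congrArg Sum.inr (Subtype.ext (h'.inj_m hx').symm)⟩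
  choose o ho ho' using key
  have hd : ∀ d, o (g d) = .inl (f d) := fun d => ho _ d rfl
  have hx : ∀ x : {x : R // x ∉ Set.range r}, o (n x.1) = .inr x := fun x => ho' _ x rfl
  have hcases : ∀ p, (∃ d, g d = p) ∨ ∃ x : {x : R // x ∉ Set.range r}, n x.1 = p := by
    intro p
    obtain ⟨x, rfl⟩ | hp := h'.cover p
    · by_cases hx : x ∈ Set.range r
      · obtain ⟨y, rfl⟩ := hx
        exact Or.inl ⟨k y, (h'.comm y).symm⟩
      · exact Or.inr ⟨⟨x, hx⟩, rfl⟩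
    · exact Or.inl hp
  refine ⟨o, ?_, hd, fun y => by rw [h'.comm, hd, h.comm], hx⟩
  intro p p' hpp
  obtain ⟨d, rfl⟩ | ⟨x, rfl⟩ := hcases p <;> obtain ⟨d', rfl⟩ | ⟨x', rfl⟩ := hcases p'
  · rw [hd, hd] at hpp
    rw [h.inj_f (Sum.inl_injective hpp)]
  · simp [hd, hx] at hpp
  · simp [hd, hx] at hpp
  · rw [hx, hx] at hpp
    rw [Sum.inr_injective hpp]

/-- The items of the result of a transformation: created ones, those of the context of the rule,
and those of the host graph outside the match. -/
theorem bijective_result_items {K L R D H P L' : Type*} {l : K → L} {k : K → D} {m : L → H}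
    {f : D → H} {r : K → R} {n : R → P} {g : D → P} (h : IsBicartesian l k m f)
    (h' : IsBicartesian r k n g) {m' : L' → H} (hm' : Function.Injective m')
    (hcover : Set.range m ∪ Set.range m' = Set.univ)
    (c : {x : L' // m' x ∉ Set.range m} → D) (hc : ∀ x, f (c x) = m' x.1) :
    Function.Bijective (Sum.elim
      (Sum.elim (fun x : {x : R // x ∉ Set.range r} => n x.1) fun y => n (r y))
      fun x => g (c x)) := by
  constructor
  · refine Function.Injective.sumElim (Function.Injective.sumElim
      (h'.inj_m.comp Subtype.val_injective) (h'.inj_m.comp h'.inj_l) ?_) ?_ ?_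
    · rintro x y hxy
      exact x.2 ⟨y, (h'.inj_m hxy).symm⟩
    · intro x y hxy
      exact Subtype.ext (hm' (by rw [← hc, ← hc, h'.inj_f hxy]))
    -- A coincidence would come from an item of `K`, and would put the host item `f (c d)` into the
    -- image of the match `m`.
    · have key : ∀ x d, n x ≠ g (c d) := by
        intro x d hxd
        obtain ⟨y, -, hy⟩ := h'.meet _ _ hxd
        exact d.2 ⟨l y, by rw [h.comm, hy, hc]⟩
      rintro (x | y) d
      · exact key _ _
      · exact key _ _
  · intro p
    obtain ⟨x, rfl⟩ | ⟨d, rfl⟩ := h'.cover p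
    · by_cases hx : x ∈ Set.range r
      · obtain ⟨y, rfl⟩ := hx
        exact ⟨.inl (.inr y), rfl⟩
      · exact ⟨.inl (.inl ⟨x, hx⟩), rfl⟩
    -- An item of `D` whose host item is matched comes from `K`; otherwise the other match covers
    -- it.
    · by_cases hd : f d ∈ Set.range m
      · obtain ⟨x, hx⟩ := hd
        obtain ⟨y, -, rfl⟩ := h.meet _ _ hx
        exact ⟨.inl (.inr y), h'.comm y⟩
      · obtain ⟨x, hx⟩ := ((Set.ext_iff.1 hcover (f d)).2 trivial).resolve_left hd
        refine ⟨.inr ⟨x, hx ▸ hd⟩, congrArg g (h.inj_f ?_)⟩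
        rw [hc, hx]

/-- The store `𝔹₀` is only required to be equivalent to the matched equations, so that the statement
also serves for the second rule, whose critical-pair state carries the equations written from the
first rule to the second. -/
theorem isGStateBasedOn_result [Infinite Var] {F : Set (Σ n, (Lang Lx).Functions n)}
    (hCT : IsConstraintTheory CT F) {D : TypedGraph.{a, b} TG} {k : r₁.K ⟶ D} {f : D ⟶ G}
    {n : r₁.R ⟶ P} {g : D ⟶ P} (hL : IsSquare r₁.l k m₁ f) (hR : IsSquare r₁.r k n g)
    (h₂ : Inj m₂)
    (hdeg₂ : ∀ x ∉ Set.range (nodeMap r₂.l), G.deg (nodeMap m₂ x) = r₂.L.deg x)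
    (hcover : Set.range (itemMap m₁) ∪ Set.range (itemMap m₂) = Set.univ)
    (hν : ν₁.Apart ν₂) (𝔹₀ : Store Lx Var) (h𝔹₀ : StoreEquiv CT 𝔹₀ (matchedEqs ν₁ ν₂ m₁ m₂))
    (𝕍 : Set Var) :
    IsGStateBasedOn CT
      ⟨(encode r₁ ν₁).bodyU + unmatched ν₂ m₂ m₁, (encode r₁ ν₁).bodyB + 𝔹₀, 𝕍⟩ P := by
  classical
  have hdeg₁ : ∀ x ∉ Set.range (nodeMap r₁.l), G.deg (nodeMap m₁ x) = r₁.L.deg x :=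
    fun x hx => hL.deg_of_notMem hx
  have hdegP : ∀ v : r₁.K.V, (G.deg (nodeMap m₁ (nodeMap r₁.l v)) : ℤ) -
      r₁.L.deg (nodeMap r₁.l v) + r₁.R.deg (nodeMap r₁.r v) =
        P.deg (nodeMap n (nodeMap r₁.r v)) := by
    intro v
    have e₁ := hL.deg_add v
    have e₂ := hR.deg_add v
    omega
  obtain ⟨o, ho, hoD, hoK, hoR⟩ := exists_origin hL.item hR.item
  obtain ⟨ν, θ, hνinj, hid, hd, hequiv⟩ := stateEquiv_of_classes (CT := CT)
    ((encode r₁ ν₁).bodyU + unmatched ν₂ m₂ m₁)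
    ((encode r₁ ν₁).bodyB + 𝔹₀ + (degStore ν₁ m₁ + degStore ν₂ m₂))
    (J := RuleItem r₁ ⊕ r₂.L.Item) (D := (r₁.K.V ⊕ r₁.K.V) ⊕ r₂.K.V)
    (T := (G.Item ⊕ {x : r₁.R.Item // x ∉ Set.range (itemMap r₁.r)}) ⊕ P.Item)
    (Sum.elim ν₁.var fun x => ν₂.var (.inl x))
    (Sum.elim (Sum.elim (fun v => ν₁.dvar (.inl (.inl (nodeMap r₁.l v))))
        fun v => ν₁.dvar (.inr (.inr v)))
      fun v => ν₂.dvar (.inl (.inl (nodeMap r₂.l v))))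
    (injective_resultVars hν)
    (Sum.elim (Sum.elim (fun x => .inl (.inl (itemMap m₁ x)))
        (Sum.elim (fun x => .inl (.inr x))
          fun v => .inl (.inl (itemMap m₁ (itemMap r₁.l (.inl v))))))
      fun x => .inl (.inl (itemMap m₂ x)))
    (Sum.elim (Sum.elim (fun v => G.deg (nodeMap m₁ (nodeMap r₁.l v)))
        fun v => P.deg (nodeMap n (nodeMap r₁.r v)))
      fun v => G.deg (nodeMap m₂ (nodeMap r₂.l v)))
    (by
      intro M η
      rw [storeHolds_add, storeHolds_add, storeHolds_add, h𝔹₀ M η]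
      constructor
      · rintro ⟨⟨hb, he⟩, hd₁, hd₂⟩
        rw [storeHolds_matchedEqs_iff hdeg₁ hdeg₂ hd₁ hd₂] at he
        rw [storeHolds_degStore] at hd₁ hd₂
        rw [storeHolds_bodyB] at hb
        have hinj := hL.item.inj_m
        have h11 : ∀ x y, itemMap m₁ x = itemMap m₁ y →
            η (ν₁.var (.inl x)) = η (ν₁.var (.inl y)) := fun x y h => by rw [hinj h]
        have h22 : ∀ x y, itemMap m₂ x = itemMap m₂ y →
            η (ν₂.var (.inl x)) = η (ν₂.var (.inl y)) := fun x y h => by rw [h₂.itemMap h]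
        have hcopy : ∀ v, η (ν₁.var (.inr (.inr v))) =
            η (ν₁.var (.inl (itemMap r₁.l (.inl v)))) := fun v => (hb v).1.symm
        refine ⟨?_, ?_⟩
        -- Copies are traded for their originals by `hcopy`. Then equal classes on the same side
        -- mean equal items, those on different sides are matched, and a created item shares its
        -- class with nothing else.
        · rintro ((x | x | x) | x) ((y | y | y) | y) hxy <;>
            simp only [Sum.elim_inl, Sum.elim_inr, Sum.inl.injEq, Sum.inr.injEq, hcopy,
              reduceCtorEq] at hxy ⊢
          · exact h11 _ _ hxy
          · exact h11 _ _ hxy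
          · exact he _ _ hxy
          · rw [hxy]
          · exact h11 _ _ hxy
          · exact h11 _ _ hxy
          · exact he _ _ hxy
          · exact (he _ _ hxy.symm).symm
          · exact (he _ _ hxy.symm).symm
          · exact h22 _ _ hxy
        · rintro ((v | v) | v)
          · exact hd₁ v
          · exact ((hb v).2.trans (realize_adjustment hCT M η _ _ _ _ (hd₁ v))).trans
              (by rw [hdegP]; rfl)
          · exact hd₂ v
      · rintro ⟨hid, hd⟩
        have hd₁ := storeHolds_degStore.2 fun v => hd (.inl (.inl v))
        have hd₂ := storeHolds_degStore.2 fun v => hd (.inr v)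
        refine ⟨⟨storeHolds_bodyB.2 fun v => ⟨?_, ?_⟩, ?_⟩, hd₁, hd₂⟩
        · exact hid (.inl (.inl (.inl (nodeMap r₁.l v)))) (.inl (.inr (.inr v))) rfl
        · refine (hd (.inl (.inr v))).trans (Eq.symm ?_)
          refine (realize_adjustment hCT M η (.var (ν₁.dvar (.inl (.inl (nodeMap r₁.l v)))))
            (G.deg (nodeMap m₁ (nodeMap r₁.l v))) _ _ (hd (.inl (.inl v)))).trans ?_
          exact congrArg (fun c : ℤ => (cst c : (Lang Lx).Term Var).realize η) (hdegP v)
        · rw [storeHolds_matchedEqs_iff hdeg₁ hdeg₂ hd₁ hd₂]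
          exact fun x y hxy => hid (.inl (.inl x)) (.inr y)
            (congrArg (fun t => Sum.inl (Sum.inl t)) hxy))
  -- An item of `P` takes the class variable of its origin, which is injective as `o` is. The
  -- summand `P.Item` of the classes supplies the degree variables that `VarMap` demands.
  let μ : P.Item → Var := fun x => ν (.inl (o x))
  let ν' : VarMap P.Item Var := ⟨μ, fun x => ν (.inr x), by
    have : Sum.elim μ (fun x => ν (.inr x)) = ν ∘ Sum.map o id := by
      funext x
      rcases x with x | x <;> rfl
    rw [this]
    exact hνinj.comp (ho.sumMap Function.injective_id)⟩
  refine isGStateBasedOn_of_storeEquiv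
    ((hasDegreeForm_bodyB r₁ ν₁).add ((hasDegreeForm_matchedEqs hdeg₁ hdeg₂).congr h𝔹₀))
    (degStore ν₁ m₁ + degStore ν₂ m₂) (fun β hβ => (Multiset.mem_add.1 hβ).elim
      isConstEq_of_mem_degStore isConstEq_of_mem_degStore) ν' ?_
  convert hequiv using 2
  have hθL : ∀ x, θ (ν₁.var (.inl x)) = .var (ν (.inl (.inl (itemMap m₁ x)))) :=
    fun x => hid (.inl (.inl x))
  have hθR : ∀ x : r₁.R.Item, θ (ν₁.var (ofR r₁ x)) = .var (μ (itemMap n x)) := by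
    intro x
    unfold ofR
    split_ifs with hx
    · have := hoK hx.choose
      rw [hx.choose_spec] at this
      rw [hθL, ← this]
    · exact (hid (.inl (.inr (.inl ⟨x, hx⟩)))).trans
        (congrArg (fun t => Term.var (ν (.inl t))) (hoR ⟨x, hx⟩).symm)
  have hc : ∀ x : {x : r₂.L.Item // itemMap m₂ x ∉ Set.range (itemMap m₁)},
      ∃ d, itemMap f d = itemMap m₂ x.1 := fun x =>
    (hL.item.cover (itemMap m₂ x.1)).resolve_left x.2
  choose c hc using hc
  have hE : ∀ e : r₁.R.E, User.bind θ (chr r₁.R (ν₁.var ∘ ofR r₁) (ν₁.dvar ∘ ofR r₁) .kp (.inr e)) =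
      chr P ν'.var ν'.dvar .gnd (itemMap n (.inr e)) := by
    intro e
    refine edgeC_bind_eq_chr P _ _ θ _ (typ_edgeMap n e) (hθR _) ?_ ?_
    · rw [← nodeMap_src]
      exact hθR _
    · rw [← nodeMap_tgt]
      exact hθR _
  have hKsum : (Finset.univ : Finset r₁.K.Item).val.map
      (fun y => chr (Lx := Lx) P ν'.var ν'.dvar .gnd (itemMap n (itemMap r₁.r y))) = _ :=
    map_univ_val_of_bijective (X := r₁.K.V) (Y := r₁.K.E) id Function.bijective_id _
  have hq := bijective_result_items hL.item hR.item h₂.itemMap hcover c hc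
  rw [chrGraph, map_univ_val_of_bijective _ hq, Multiset.map_add]
  refine congrArg₂ (· + ·) ?_ ?_
  · have hsum := map_univ_val_of_bijective
      (X := {x : r₁.R.Item // x ∉ Set.range (itemMap r₁.r)}) (Y := r₁.K.Item) id
      Function.bijective_id (fun x => chr (Lx := Lx) P ν'.var ν'.dvar .gnd
        (Sum.elim (fun x => itemMap n x.1) (fun y => itemMap n (itemMap r₁.r y)) x))
    refine hsum.trans ?_
    simp only [id, Sum.elim_inl, Sum.elim_inr]
    -- The body of the rule lists the edges of `K` before its nodes, hence the exchange of summands.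
    rw [hKsum, encode, Multiset.map_add, Multiset.map_add, Multiset.map_map, Multiset.map_map,
      Multiset.map_map, add_comm (Multiset.map _ (Finset.univ : Finset r₁.K.V).val),
      ← add_assoc]
    refine congrArg₂ (· + ·) (congrArg₂ (· + ·) ?_ ?_) ?_
    · refine Multiset.map_congr rfl fun x _ => ?_
      obtain ⟨x | e, hx⟩ := x
      · refine (nodeC_bind_eq_chr P _ _ θ _ (typ_nodeMap n x) (hθR _) ?_).symm
        rw [subst_cst, hR.deg_of_notMem fun h => hx ((inl_mem_range_itemMap _ _).2 h)]
      · exact (hE e).symm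
    · exact Multiset.map_congr rfl fun e _ => (hE (edgeMap r₁.r e)).symm
    · refine Multiset.map_congr rfl fun v _ => ?_
      have hdv : (Term.var (ν₁.dvar (.inr (.inr v)))).subst θ =
          cst (P.deg (nodeMap n (nodeMap r₁.r v))) := hd (.inl (.inr v))
      refine (nodeC_bind_eq_chr P _ _ θ _ ?_ ?_ hdv).symm
      · rw [typ_nodeMap, typ_nodeMap]
      · exact (hid (.inl (.inr (.inr v)))).trans
          (congrArg (fun t => Term.var (ν (.inl t))) (hoK (.inl v)).symm)
  · rw [unmatched, Multiset.map_map]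
    -- This is needed for all items, not only the unmatched ones: an unmatched edge may end in a
    -- matched node, which is then preserved because it lies in `D`.
    have hθ₂ : ∀ x d, itemMap f d = itemMap m₂ x →
        θ (ν₂.var (.inl x)) = .var (μ (itemMap g d)) := by
      intro x d hx
      exact (hid (.inr x)).trans
        (congrArg (fun t => Term.var (ν (.inl t))) ((hoD d).trans (congrArg _ hx)).symm)
    refine Multiset.map_congr rfl fun x _ => ?_
    change chr P ν'.var ν'.dvar .gnd (itemMap g (c x)) = User.bind θ (headC r₂ ν₂ x.1)
    have hcx := hc x
    generalize c x = d at hcx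
    obtain ⟨x | e, hx⟩ := x
    · obtain d | d := d
      · have hfd : nodeMap f d = nodeMap m₂ x := Sum.inl_injective hcx
        -- A node outside the first match is not in the image of `K`, so by the flipped squares its
        -- degrees in `G`, `D` and `P` coincide.
        have hdk : d ∉ Set.range (nodeMap k) := by
          rintro ⟨y, rfl⟩
          refine hx ⟨.inl (nodeMap r₁.l y), congrArg Sum.inl ?_⟩
          rw [hL.node.comm, hfd]
        rw [headC_inl]
        refine (nodeC_bind_eq_chr P _ _ θ _ ?_ (hθ₂ _ _ hcx) ?_).symm
        · rw [typ_nodeMap, ← typ_nodeMap f, hfd, typ_nodeMap]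
        · rw [subst_degTerm (fun v => hd (.inr v)) hdeg₂, ← hfd, hL.flip.deg_of_notMem hdk,
            hR.flip.deg_of_notMem hdk]
      · simp [itemMap] at hcx
    · obtain d | d := d
      · simp [itemMap] at hcx
      · have hfd : edgeMap f d = edgeMap m₂ e := Sum.inr_injective hcx
        rw [headC_inr]
        have hsrc : nodeMap f (D.src d) = nodeMap m₂ (r₂.L.src e) := by
          rw [nodeMap_src, nodeMap_src, hfd]
        have htgt : nodeMap f (D.tgt d) = nodeMap m₂ (r₂.L.tgt e) := by
          rw [nodeMap_tgt, nodeMap_tgt, hfd]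
        refine (edgeC_bind_eq_chr P _ _ θ _ ?_ (hθ₂ _ _ hcx) ?_ ?_).symm
        · rw [typ_edgeMap, ← typ_edgeMap f, hfd, typ_edgeMap]
        · exact (hθ₂ (.inl (r₂.L.src e)) (.inl (D.src d)) (congrArg Sum.inl hsrc)).trans
            (congrArg (fun t => Term.var (μ (.inl t))) (nodeMap_src g d))
        · exact (hθ₂ (.inl (r₂.L.tgt e)) (.inl (D.tgt d)) (congrArg Sum.inl htgt)).trans
            (congrArg (fun t => Term.var (μ (.inl t))) (nodeMap_tgt g d))

theorem matchedPairs_ne_zero (h : ¬ ParallelIndependent r₁ r₂ G m₁ m₂) :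
    matchedPairs (Lx := Lx) ν₁ ν₂ m₁ m₂ ≠ 0 := by
  classical
  obtain ⟨g, ⟨⟨x, hx⟩, y, hy⟩, -⟩ := Set.not_subset.1 h
  intro h₀
  have : (headC (Lx := Lx) r₁ ν₁ x, headC (Lx := Lx) r₂ ν₂ y) ∈ matchedPairs ν₁ ν₂ m₁ m₂ :=
    Multiset.mem_map.2 ⟨⟨(x, y), hx.trans hy.symm⟩, Finset.mem_univ _, rfl⟩
  rw [h₀] at this
  simp at this

end States

end Encoding

/-! ### The overlap of a critical pair -/

theorem mainTheorem10 {TG : GTS.Graph.{a}} {Lx : FirstOrder.Language.{u, v}} {Var : Type w}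
    [Infinite Var] (CT : (CHR.Lang Lx).Theory) (F : Set (Σ n, (CHR.Lang Lx).Functions n))
    (hCT : CHR.IsConstraintTheory CT F)
    (r₁ r₂ : GTS.Rule.{a, b} TG) (G P₁ P₂ : GTS.TypedGraph.{a, b} TG)
    (m₁ : r₁.L ⟶ G) (m₂ : r₂.L ⟶ G)
    (hcrit : GTS.IsCriticalPair r₁ r₂ G P₁ P₂ m₁ m₂)
    (ν₁ : Encoding.VarMap (Encoding.RuleItem r₁) Var)
    (ν₂ : Encoding.VarMap (Encoding.RuleItem r₂) Var) :
    ∃ o : CHR.Overlap CT (Encoding.encode r₁ ν₁) (Encoding.encode r₂ ν₂),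
      Encoding.IsGStateBasedOn CT o.state G ∧
        Encoding.IsGStateBasedOn CT o.left P₁ ∧
          Encoding.IsGStateBasedOn CT o.right P₂ := by
  obtain ⟨D₁, k₁, f₁, n₁, g₁, hL₁, hR₁⟩ := hcrit.left.exists_isSquare
  obtain ⟨D₂, k₂, f₂, n₂, g₂, hL₂, hR₂⟩ := hcrit.right.exists_isSquare
  have h₁ := hcrit.left.1
  have h₂ := hcrit.right.1
  have hdeg₁ : ∀ x ∉ Set.range (GTS.nodeMap r₁.l), G.deg (GTS.nodeMap m₁ x) = r₁.L.deg x :=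
    fun x hx => hL₁.deg_of_notMem hx
  have hdeg₂ : ∀ x ∉ Set.range (GTS.nodeMap r₂.l), G.deg (GTS.nodeMap m₂ x) = r₂.L.deg x :=
    fun x hx => hL₂.deg_of_notMem hx
  have hcover := hcrit.jointly_surjective
  -- Renaming the second rule suffices. The permutation separates the whole ranges of the
  -- assignments, including variables that do not occur in the rules, since `Apart` speaks of all of
  -- them.
  obtain ⟨ρ, hρ⟩ := CHR.exists_perm_disjoint (Var := Var)
    ((Set.finite_range (Sum.elim ν₂.var ν₂.dvar)).union
      (Encoding.encode (Lx := Lx) r₂ ν₂).vars_finite)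
    ((Set.finite_range (Sum.elim ν₁.var ν₁.dvar)).union
      (Encoding.encode (Lx := Lx) r₁ ν₁).vars_finite)
  have hren₁ : (Encoding.encode (Lx := Lx) r₁ ν₁).rename (Equiv.refl Var) =
      Encoding.encode r₁ ν₁ :=
    Encoding.encode_rename r₁ ν₁ (Equiv.refl Var)
  have hren₂ := Encoding.encode_rename (Lx := Lx) r₂ ν₂ ρ
  have hν : ν₁.Apart (ν₂.rename ρ) := by
    intro i j hij
    refine Set.disjoint_left.1 hρ (Or.inl ⟨i, rfl⟩) ⟨_, Or.inl ⟨j, rfl⟩, ?_⟩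
    rw [hij]
    rcases j with j | j <;> rfl
  let o : CHR.Overlap CT (Encoding.encode r₁ ν₁) (Encoding.encode r₂ ν₂) :=
    { ρ₁ := Equiv.refl Var
      ρ₂ := ρ
      renamed_apart := by
        rw [hren₁]
        exact hρ.mono Set.subset_union_right
          ((CHR.Rule.vars_rename _ _).trans (Set.image_mono Set.subset_union_right))
      H₁ := Encoding.unmatched ν₁ m₁ m₂
      H₂ := Encoding.unmatched (ν₂.rename ρ) m₂ m₁
      A := Encoding.matchedPairs ν₁ (ν₂.rename ρ) m₁ m₂
      head₁ := by rw [hren₁, Encoding.encode_head_eq_left _ _ _ _ h₂]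
      head₂ := by rw [hren₂, Encoding.encode_head_eq_right _ _ _ _ h₁]
      nonempty := Encoding.matchedPairs_ne_zero hcrit.dependent
      satisfiable := Encoding.satisfiable_matchedEqs hdeg₁ hdeg₂ hν }
  refine ⟨o, ?_, ?_, ?_⟩
  · have := Encoding.isGStateBasedOn_overlap (CT := CT) h₁ h₂ hdeg₁ hdeg₂ hcover hν o.globals
    rwa [Encoding.encode_head_eq_left _ (ν₂.rename ρ) _ _ h₂] at this
  · have := Encoding.isGStateBasedOn_result hCT hL₁ hR₁ h₂ hdeg₂ hcover hν _
      (fun _ _ => Iff.rfl)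
    rw [← hren₁] at this
    exact this o.globals
  -- The roles of the rules are exchanged; symmetry of the equations accounts for their fixed
  -- orientation in the overlap.
  · have := Encoding.isGStateBasedOn_result hCT hL₂ hR₂ h₁ hdeg₁
      ((Set.union_comm _ _).trans hcover) hν.symm _
      (Encoding.matchedEqs_comm ν₁ (ν₂.rename ρ) m₁ m₂)
    rw [← hren₂] at this
    exact this o.globals
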